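/- **The 1G1B system.** Let $\lambda>0$, $\mu\ge 0$, $q,p\in[0,1]$, $\Gamma\ge 0$, and assume $\mu+\lambda q(1-p)>0$ (which holds whenever $\mu>0$). Let $(s(t))_{t\ge0}$ be the continuous-time Markov chain with state space $\{\emptyset,0,1,2,\dots\}$, with $s(0)=\emptyset$ and with transition rates $\lambda$ from $\emptyset$ to $0$, $\lambda qp$ from $i$ to $i+1$, and $\mu+\lambda q(1-p)$ from $i$ to $\emptyset$ ($i\ge 0$); all other transition rates are zero. If $s(t)=i\ge0$, let $\vec T(t)=(T_0(t),\dots,T_i(t))$, where, for $j<i$, $T_j(t)$ is the time spent in the most recent visit to state $j$ before $t$, and $T_i(t)$ is the time spent so far in state $i$ in the current visit. **The fidelity.** Let $\rho_{\mathrm{new}}$ be a two-qubit density matrix with fidelity $F_{\mathrm{new}}=\langle\phi^+|\rho_{\mathrm{new}}|\phi^+\rangle$, where $|\phi^+\rangle=(|00\rangle+|11\rangle)/\sqrt2$, and let $J(\cdot,\rho_{\mathrm{new}}):[0,1]\to[0,1]$ be continuous (the jump function). For $t\ge0$ put $D_t[F]=e^{-\Gamma t}\left(F-\tfrac14\right)+\tfrac14$,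 and define recursively $$F^{(0)}(t_0)=D_{t_0}[F_{\mathrm{new}}],\qquad F^{(i)}(t_0,\dots,t_i)=D_{t_i}\!\left[J\!\left(F^{(i-1)}(t_0,\dots,t_{i-1}),\rho_{\mathrm{new}}\right)\right]\quad(i\ge1).$$ Let $F(t)=F^{(i)}(\vec T(t))$ if $s(t)=i\ge0$, and $F(t)=0$ if $s(t)=\emptyset$. **Theorem.** The limits $\pi_x=\lim_{t\to\infty}P(s(t)=x)$ exist for all $x\in\{\emptyset,0,1,\dots\}$, the availability $A=1-\pi_\emptyset$ is positive, and the average consumed fidelity $\overline F=\lim_{t\to\infty}\mathbb E[F(t)\mid s(t)\ne\emptyset]$ exists and equals $$\overline F=\frac1A\sum_{i=0}^\infty c_i\,\pi_i,\qquad c_i=\mathbb E\!\left[F^{(i)}(Q_0,\dots,Q_i)\right],$$ where $Q_0,Q_1,\dots$ are i.i.d. exponential random variables with rate $\mu+\lambda q$, and the series converges. Moreover, for every $i\ge0$ with $\pi_i>0$, conditionally on $s(t)=i$, the vector $\vec T(t)$ converges in distribution to $(Q_0,\dots,Q_i)$ as $t\to\infty$. -/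

import Mathlib

open MeasureTheory ProbabilityTheory Filter Topology Set
open scoped NNReal Matrix ComplexOrder

noncomputable section

namespace Buffer

/-! ### Two-qubit states -/

/-- Operators on two qubits, in the computational basis. -/
abbrev TwoQubit : Type := Matrix (Fin 2 × Fin 2) (Fin 2 × Fin 2) ℂ

/-- `ρ` is a density matrix. -/
def IsState (ρ : TwoQubit) : Prop := ρ.PosSemidef ∧ ρ.trace = 1

/-- The Bell state `(|00⟩ + |11⟩) / √2`. -/
def phiPlus : Fin 2 × Fin 2 → ℂ := fun x => if x.1 = x.2 then ((Real.sqrt 2)⁻¹ : ℝ) else 0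

/-- Fidelity `⟨φ⁺| ρ |φ⁺⟩` of a two-qubit state with the target Bell state. -/
def fidelity (ρ : TwoQubit) : ℝ := (star phiPlus ⬝ᵥ ρ *ᵥ phiPlus).re

/-! ### Continuous-time Markov chains through jump chain and holding times -/

section CTMC

variable {S Ω : Type*}

/-- Total rate of leaving the state `x`, for the off-diagonal transition rates `r`. -/
def exitRate (r : S → S → ℝ) (x : S) : ℝ := ∑' y, r x y

/-- `s` is a continuous-time Markov chain on the countable state space `S`, started in `x₀`, with
off-diagonal transition rates `r` (where `r x x = 0` and every state has a finite positive exit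
rate). There is a jump chain `Y` and a sequence `H` of holding times: `Y` is a Markov chain started
in `x₀` that moves from `x` to `y` with probability `r x y / exitRate r x`; given `Y`, the holding
times are independent and `H k` is exponential with rate `exitRate r (Y k)`; and `s` is equal
to `Y n` from the `n`-th jump time (included) to the next one (excluded). -/
def IsCTMC [MeasurableSpace Ω] (P : Measure Ω) (r : S → S → ℝ) (x₀ : S)
    (s : ℝ≥0 → Ω → S) : Prop :=
  (∀ t x, MeasurableSet {ω | s t ω = x}) ∧
  ∃ (Y : ℕ → Ω → S) (H : ℕ → Ω → ℝ),
    (∀ n x, MeasurableSet {ω | Y n ω = x}) ∧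
    (∀ n, Measurable (H n)) ∧
    (∀ (y : ℕ → S), y 0 = x₀ → ∀ (u : ℕ → ℝ), (∀ k, 0 ≤ u k) → ∀ n : ℕ,
      P.real {ω | (∀ k ≤ n, Y k ω = y k) ∧ ∀ k < n, u k < H k ω} =
        ∏ k ∈ Finset.range n,
          Real.exp (-(exitRate r (y k) * u k)) * (r (y k) (y (k + 1)) / exitRate r (y k))) ∧
    (∀ᵐ ω ∂P, ∀ (n : ℕ) (t : ℝ≥0),
      ∑ k ∈ Finset.range n, H k ω ≤ t → t < ∑ k ∈ Finset.range (n + 1), H k ω →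
        s t ω = Y n ω)

end CTMC

/-! ### The 1G1B system -/

/-- Transition rates of the 1G1B system. The state `none` means that there is no link in memory,
`some i` that there is a link which is the result of `i` successful pumping rounds. -/
def rate (lam mu q p : ℝ) : Option ℕ → Option ℕ → ℝ
  | none, none => 0
  | none, some j => if j = 0 then lam else 0
  | some _, none => mu + lam * q * (1 - p)
  | some i, some j => if j = i + 1 then lam * q * p else 0

/-- `s` is the state process of a 1G1B system with generation rate `lam`, consumption rate `mu`,
pumping probability `q` and success probability `p`; it starts with no link. -/
def Is1G1B {Ω : Type*} [MeasurableSpace Ω] (P : Measure Ω) (lam mu q p : ℝ)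
    (s : ℝ≥0 → Ω → Option ℕ) : Prop :=
  IsCTMC P (rate lam mu q p) none s

/-- End, by time `t`, of the most recent visit of the path `f` to level `j`
(this is `t` itself if `f t = some j`). -/
def visitEnd (f : ℝ≥0 → Option ℕ) (t : ℝ≥0) (j : ℕ) : ℝ≥0 :=
  sSup {u | u ≤ t ∧ f u = some j}

/-- Beginning of the most recent visit, by time `t`, of the path `f` to level `j`. -/
def visitStart (f : ℝ≥0 → Option ℕ) (t : ℝ≥0) (j : ℕ) : ℝ≥0 :=
  sInf {u | u ≤ visitEnd f t j ∧ ∀ v, u ≤ v → v < visitEnd f t j → f v = some j}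

/-- The vector of the times spent in levels `0, …, i` during the most recent visits to them
by time `t`. -/
def levelTimes (f : ℝ≥0 → Option ℕ) (t : ℝ≥0) (i : ℕ) : Fin (i + 1) → ℝ :=
  fun j => (visitEnd f t j : ℝ) - (visitStart f t j : ℝ)

/-- Depolarising noise of rate `Γ`, acting for a time `t` on the fidelity `F`. -/
def depol (Γ t F : ℝ) : ℝ := Real.exp (-(Γ * t)) * (F - 1 / 4) + 1 / 4

/-- The fidelity of a link after it has spent the times `t 0, …, t i` in the purification levels
`0, …, i`, where `J F ρ` is the jump function of the pumping protocol. -/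
def levelFidelity (Γ : ℝ) (J : ℝ → TwoQubit → ℝ) (ρnew : TwoQubit) :
    (i : ℕ) → (Fin (i + 1) → ℝ) → ℝ
  | 0, t => depol Γ (t 0) (fidelity ρnew)
  | i + 1, t =>
      depol Γ (t (Fin.last (i + 1)))
        (J (levelFidelity Γ J ρnew i (fun j => t j.castSucc)) ρnew)

/-- The fidelity at time `t` of the system that follows the path `f`. -/
def pathFidelity (Γ : ℝ) (J : ℝ → TwoQubit → ℝ) (ρnew : TwoQubit)
    (f : ℝ≥0 → Option ℕ) (t : ℝ≥0) : ℝ :=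
  match f t with
  | none => 0
  | some i => levelFidelity Γ J ρnew i (levelTimes f t i)

/-- The joint law of `i + 1` independent exponential random variables of rate `a`. -/
def iidExp (a : ℝ) (i : ℕ) : Measure (Fin (i + 1) → ℝ) :=
  Measure.pi fun _ => expMeasure a

end Buffer

end

/-! Write a = μ + λq and β = μ + λq(1 - p). The joint law of the level times can be computed exactly
at every fixed time t, before any limit is taken. Look at the last jump before t, from x to z. The
density of an exponential clock is its rate times its survival function. So the density of "a clock
of rate e rings after h, then a clock of rate e' survives for τ - h" treats the two clocks
symmetrically, up to the factor e/e'. Hence the age v of the visit to z may be drawn as an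
exponential variable with the exit rate of z, while the completed holding time in x becomes the age
of a visit in progress at time t - v (`lintegral_expMeasure_swap`, `lintegral_last_jump`). A link at
level i has climbed none → 0 → … → i. Iterating along the climb (`lintegral_climb`) and summing over
the jump where it starts gives the key formula: on s(t) = i, the level times x have density w_i ·
P(s(t - Σ x_j) = none) with respect to i.i.d. exponentials of rate a, where w_i = (λ/a)(λqp/a)^i
(`lintegral_levelTimes`, `map_levelTimes`). The probability is read as 0 at negative times. It
remains to find the limit of P(s(t) = none). Every level is lost at the same rate β, so the
last-jump decomposition at none is a closed renewal equation (`occupation_none_eq`, `renewal`),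
whose solution tends to β/(λ + β) (`tendsto_of_renewal`). Dominated convergence in the key formula
then gives π_i = w_i π_none, the limiting conditional law and the contribution of each level to the
fidelity. Finally P(s(t) = i) ≤ w_i for all t, and Σ w_i converges because λqp < a, so the limit
passes through the sum over levels. Two preliminaries make this legitimate: the Markov property,
extracted from the finite-dimensional laws by a π-system argument (`measure_inter_step`), and
non-explosion, which follows from bounded exit rates (`ae_exists_lt_jumpTime`). -/

namespace Buffer

/-! ### Markov property at the jump times -/

section MarkovStep

variable {S Ω : Type*} [MeasurableSpace Ω]

/-- `Y` is the jump chain and `H` the sequence of holding times of a continuous-time Markov chain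
with rates `r` started in `x₀`. -/
structure IsJumpHold (P : Measure Ω) (r : S → S → ℝ) (x₀ : S) (Y : ℕ → Ω → S)
    (H : ℕ → Ω → ℝ) : Prop where
  meas_Y : ∀ n x, MeasurableSet {ω | Y n ω = x}
  meas_H : ∀ n, Measurable (H n)
  law : ∀ (y : ℕ → S), y 0 = x₀ → ∀ (u : ℕ → ℝ), (∀ k, 0 ≤ u k) → ∀ n : ℕ,
      P.real {ω | (∀ k ≤ n, Y k ω = y k) ∧ ∀ k < n, u k < H k ω} =
        ∏ k ∈ Finset.range n,
          Real.exp (-(exitRate r (y k) * u k)) * (r (y k) (y (k + 1)) / exitRate r (y k))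

/-- The event that the first `n` jumps follow `y` and the first `n` holding times exceed `u`. -/
def cylinder {S Ω : Type*} (Y : ℕ → Ω → S) (H : ℕ → Ω → ℝ) (n : ℕ) (y : ℕ → S) (u : ℕ → ℝ) : Set Ω :=
  {ω | (∀ k ≤ n, Y k ω = y k) ∧ ∀ k < n, u k < H k ω}

/-- The information carried by the first `n` jumps and the first `n` holding times. -/
abbrev history {S Ω : Type*} (Y : ℕ → Ω → S) (H : ℕ → Ω → ℝ) (n : ℕ) : MeasurableSpace Ω :=
  MeasurableSpace.generateFrom (range fun z : (ℕ → S) × (ℕ → ℝ) => cylinder Y H n z.1 z.2)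

/-- Two cylinders that meet prescribe the same first states, so only the thresholds have to be
combined, by taking maxima. -/
lemma isPiSystem_cylinder {S Ω : Type*} (Y : ℕ → Ω → S) (H : ℕ → Ω → ℝ) (n : ℕ) :
    IsPiSystem (range fun z : (ℕ → S) × (ℕ → ℝ) => cylinder Y H n z.1 z.2) := by
  rintro _ ⟨⟨y, u⟩, rfl⟩ _ ⟨⟨y', u'⟩, rfl⟩ ⟨ω₀, h1, h2⟩
  refine ⟨(y, fun k => max (u k) (u' k)), ?_⟩
  have hyy : ∀ k ≤ n, y k = y' k := fun k hk => (h1.1 k hk).symm.trans (h2.1 k hk)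
  ext ω
  simp only [cylinder, mem_ofPred_eq, mem_inter_iff, max_lt_iff]
  constructor
  · rintro ⟨a, b⟩
    exact ⟨⟨a, fun k hk => (b k hk).1⟩, fun k hk => (a k hk).trans (hyy k hk),
      fun k hk => (b k hk).2⟩
  · rintro ⟨⟨a, b⟩, -, c⟩
    exact ⟨a, fun k hk => ⟨b k hk, c k hk⟩⟩

variable {P : Measure Ω} {r : S → S → ℝ} {x₀ : S} {Y : ℕ → Ω → S} {H : ℕ → Ω → ℝ}

/-- The set `A` need not be measurable: the fibres are, and countable additivity is applied to the
restriction of `P` to `A`. -/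
lemma measure_eq_tsum_inter_fiber [Countable S] {Z : Ω → S} (hZ : ∀ x, MeasurableSet {ω | Z ω = x})
    (P : Measure Ω) (A : Set Ω) : P A = ∑' x, P (A ∩ {ω | Z ω = x}) := by
  have hU : (⋃ x, {ω | Z ω = x}) = univ := by ext; simp
  have hd : Pairwise (Function.onFun Disjoint fun x => {ω | Z ω = x}) := by
    intro x y hxy
    refine Set.disjoint_left.2 fun ω h1 h2 => hxy ?_
    rw [← show Z ω = x from h1, ← show Z ω = y from h2]
  have := measure_iUnion (μ := P.restrict A) hd hZ
  rw [hU, Measure.restrict_apply_univ] at this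
  rw [this]
  exact tsum_congr fun x => by rw [Measure.restrict_apply (hZ x), inter_comm]

lemma measureReal_eq_tsum_inter_fiber [Countable S] [IsFiniteMeasure P] {Z : Ω → S}
    (hZ : ∀ x, MeasurableSet {ω | Z ω = x}) (A : Set Ω) :
    P.real A = ∑' x, P.real (A ∩ {ω | Z ω = x}) := by
  rw [measureReal_def, measure_eq_tsum_inter_fiber hZ,
    ENNReal.tsum_toReal_eq fun x => measure_ne_top _ _]
  rfl

lemma lintegral_eq_tsum_fiber [Countable S] {Z : Ω → S} (hZ : ∀ x, MeasurableSet {ω | Z ω = x})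
    (P : Measure Ω) (f : Ω → ENNReal) :
    ∫⁻ ω, f ω ∂P = ∑' x, ∫⁻ ω in {ω | Z ω = x}, f ω ∂P := by
  have hU : (⋃ x, {ω | Z ω = x}) = univ := by ext; simp
  rw [← lintegral_iUnion hZ, hU, setLIntegral_univ]
  intro x y hxy
  refine Set.disjoint_left.2 fun ω h1 h2 => hxy ?_
  rw [← show Z ω = x from h1, ← show Z ω = y from h2]

lemma measurableSet_cylinder_of {S Ω : Type*} {m : MeasurableSpace Ω} {Y : ℕ → Ω → S}
    {H : ℕ → Ω → ℝ} {n : ℕ}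
    (hY : ∀ k ≤ n, ∀ x, MeasurableSet {ω | Y k ω = x}) (hH : ∀ k < n, Measurable (H k))
    (y : ℕ → S) (u : ℕ → ℝ) : MeasurableSet (cylinder Y H n y u) := by
  have : cylinder Y H n y u = (⋂ k, ⋂ (_ : k ≤ n), {ω | Y k ω = y k}) ∩
      ⋂ k, ⋂ (_ : k < n), H k ⁻¹' Ioi (u k) := by
    ext; simp [cylinder]
  rw [this]
  exact (MeasurableSet.iInter fun k => MeasurableSet.iInter fun hk => hY k hk _).inter
    (MeasurableSet.iInter fun k => MeasurableSet.iInter fun hk => hH k hk measurableSet_Ioi)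

namespace IsJumpHold

lemma measurableSet_cylinder (h : IsJumpHold P r x₀ Y H) (n : ℕ) (y : ℕ → S) (u : ℕ → ℝ) :
    MeasurableSet (cylinder Y H n y u) :=
  measurableSet_cylinder_of (fun k _ => h.meas_Y k) (fun k _ => h.meas_H k) y u

lemma history_le (h : IsJumpHold P r x₀ Y H) (n : ℕ) : history Y H n ≤ ‹MeasurableSpace Ω› := by
  refine MeasurableSpace.generateFrom_le ?_
  rintro _ ⟨z, rfl⟩
  exact h.measurableSet_cylinder n _ _

/-- The defining law constrains as many holding times as jumps. Summing over the state reached by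
one more jump frees that jump and keeps its holding time, since the transition probabilities out of
`y n` add up to 1. -/
lemma measureReal_path_holds [Countable S] [IsFiniteMeasure P] (h : IsJumpHold P r x₀ Y H)
    (he : ∀ x, 0 < exitRate r x) (y : ℕ → S) (hy : y 0 = x₀) (u : ℕ → ℝ) (hu : ∀ k, 0 ≤ u k)
    (n : ℕ) :
    P.real {ω | (∀ k ≤ n, Y k ω = y k) ∧ ∀ k < n + 1, u k < H k ω} =
      (∏ k ∈ Finset.range n,
        Real.exp (-(exitRate r (y k) * u k)) * (r (y k) (y (k + 1)) / exitRate r (y k))) *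
      Real.exp (-(exitRate r (y n) * u n)) := by
  rw [measureReal_eq_tsum_inter_fiber (h.meas_Y (n + 1))]
  have key : ∀ x, P.real ({ω | (∀ k ≤ n, Y k ω = y k) ∧ ∀ k < n + 1, u k < H k ω} ∩
      {ω | Y (n + 1) ω = x}) =
      ((∏ k ∈ Finset.range n,
        Real.exp (-(exitRate r (y k) * u k)) * (r (y k) (y (k + 1)) / exitRate r (y k))) *
      Real.exp (-(exitRate r (y n) * u n))) * (r (y n) x / exitRate r (y n)) := by
    intro x
    have hne : ∀ k ≤ n, Function.update y (n + 1) x k = y k := fun k hk =>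
      Function.update_of_ne (by omega) _ _
    have hl := h.law (Function.update y (n + 1) x) (by rw [hne 0 (by omega), hy]) u hu (n + 1)
    rw [Finset.prod_range_succ, hne n le_rfl, Function.update_self, ← mul_assoc] at hl
    have hp : (∏ k ∈ Finset.range n, Real.exp (-(exitRate r (Function.update y (n + 1) x k) * u k))
        * (r (Function.update y (n + 1) x k) (Function.update y (n + 1) x (k + 1)) /
          exitRate r (Function.update y (n + 1) x k))) = ∏ k ∈ Finset.range n,
        Real.exp (-(exitRate r (y k) * u k)) * (r (y k) (y (k + 1)) / exitRate r (y k)) := by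
      refine Finset.prod_congr rfl fun k hk => ?_
      rw [Finset.mem_range] at hk
      rw [hne k (by omega), hne (k + 1) (by omega)]
    rw [hp] at hl
    rw [← hl]
    congr 1
    ext ω
    simp only [mem_inter_iff, mem_ofPred_eq]
    constructor
    · rintro ⟨⟨h1, h2⟩, h3⟩
      refine ⟨fun k hk => ?_, h2⟩
      rcases Nat.lt_or_ge n k with hk' | hk'
      · obtain rfl : k = n + 1 := by omega
        simpa using h3
      · rw [hne k hk', h1 k hk']
    · rintro ⟨h1, h2⟩
      refine ⟨⟨fun k hk => ?_, h2⟩, by simpa using h1 (n + 1) le_rfl⟩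
      rw [← hne k hk, h1 k (by omega)]
  rw [tsum_congr key, tsum_mul_left, tsum_div_const]
  have : (∑' x, r (y n) x) / exitRate r (y n) = 1 := div_self (he _).ne'
  rw [this, mul_one]

lemma ae_start [IsProbabilityMeasure P] (h : IsJumpHold P r x₀ Y H) : ∀ᵐ ω ∂P, Y 0 ω = x₀ := by
  have := h.law (fun _ => x₀) rfl (fun _ => 0) (fun _ => le_rfl) 0
  simp only [Finset.range_zero, Finset.prod_empty] at this
  rw [measureReal_def, ENNReal.toReal_eq_one_iff] at this
  have h2 := (prob_compl_eq_zero_iff (h.measurableSet_cylinder 0 (fun _ => x₀) fun _ => 0)).2 this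
  filter_upwards [compl_mem_ae_iff.2 h2] with ω hω
  rw [compl_compl] at hω
  exact hω.1 0 le_rfl

/-- Finite initial segments are countably many when the state space is countable. -/
lemma ae_of_forall_path [Countable S] {n : ℕ} {p : Ω → Prop}
    (hp : ∀ y : ℕ → S, ∀ᵐ ω ∂P, (∀ k ≤ n, Y k ω = y k) → p ω) : ∀ᵐ ω ∂P, p ω := by
  have : ∀ᵐ ω ∂P, ∀ y : Fin (n + 1) → S,
      (∀ k ≤ n, Y k ω = y (Fin.ofNat (n + 1) k)) → p ω :=
    ae_all_iff.2 fun y => hp fun k => y (Fin.ofNat (n + 1) k)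
  filter_upwards [this] with ω hω
  refine hω (fun i => Y i ω) fun k hk => ?_
  simp [Nat.mod_eq_of_lt (Nat.lt_succ_of_le hk)]

lemma ae_hold_pos [Countable S] [IsProbabilityMeasure P] (h : IsJumpHold P r x₀ Y H)
    (he : ∀ x, 0 < exitRate r x) : ∀ᵐ ω ∂P, ∀ k, 0 < H k ω := by
  suffices ∀ n, ∀ᵐ ω ∂P, ∀ k < n, 0 < H k ω by
    filter_upwards [ae_all_iff.2 this] with ω hω k
    exact hω (k + 1) k (Nat.lt_succ_self k)
  intro n
  induction n with
  | zero => simp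
  | succ n ih =>
    refine ae_of_forall_path (Y := Y) (n := n) fun y => ?_
    by_cases hy : y 0 = x₀
    -- At threshold 0 the extra exponential factor is 1, so also requiring `0 < H n` costs no
    -- probability.
    · have h1 := h.measureReal_path_holds he y hy (fun _ => 0) (fun _ => le_rfl) n
      have h2 := h.law y hy (fun _ => 0) (fun _ => le_rfl) n
      rw [mul_zero, neg_zero, Real.exp_zero, mul_one, ← h2] at h1
      have hsub : {ω | (∀ k ≤ n, Y k ω = y k) ∧ ∀ k < n + 1, 0 < H k ω} ⊆
          {ω | (∀ k ≤ n, Y k ω = y k) ∧ ∀ k < n, 0 < H k ω} :=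
        fun ω hω => ⟨hω.1, fun k hk => hω.2 k (by omega)⟩
      have hm : MeasurableSet {ω | (∀ k ≤ n, Y k ω = y k) ∧ ∀ k < n + 1, 0 < H k ω} := by
        have : {ω | (∀ k ≤ n, Y k ω = y k) ∧ ∀ k < n + 1, 0 < H k ω} =
            cylinder Y H n y (fun _ => 0) ∩ H n ⁻¹' Ioi 0 := by
          ext ω
          simp only [cylinder, mem_ofPred_eq, mem_inter_iff, mem_preimage, mem_Ioi,
            Nat.forall_lt_succ_right, and_assoc]
        rw [this]
        exact (h.measurableSet_cylinder n y _).inter (h.meas_H n measurableSet_Ioi)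
      have h3 := measureReal_sdiff hsub hm (μ := P)
      rw [h1, sub_self, measureReal_eq_zero_iff] at h3
      filter_upwards [ih, compl_mem_ae_iff.2 h3] with ω hω hω3 hyω
      by_contra hcon
      exact hω3 ⟨⟨hyω, hω⟩, fun hh => hcon hh.2⟩
    · filter_upwards [h.ae_start] with ω hω hyω
      exact absurd ((hyω 0 (by omega)).symm.trans hω) hy

/-- The finite-dimensional laws, without a sign condition on the thresholds. -/
lemma measureReal_cylinder [Countable S] [IsProbabilityMeasure P] (h : IsJumpHold P r x₀ Y H)
    (he : ∀ x, 0 < exitRate r x) (n : ℕ) (y : ℕ → S) (hy : y 0 = x₀) (u : ℕ → ℝ) :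
    P.real (cylinder Y H n y u) = ∏ k ∈ Finset.range n,
      Real.exp (-(exitRate r (y k) * max (u k) 0)) *
        (r (y k) (y (k + 1)) / exitRate r (y k)) := by
  rw [← h.law y hy (fun k => max (u k) 0) (fun k => le_max_right _ _) n]
  refine measureReal_congr ?_
  filter_upwards [h.ae_hold_pos he] with ω hω
  simp only [cylinder, eq_iff_iff]
  change (_ ∧ _) ↔ (_ ∧ _)
  simp [hω]

/-- The Markov property at the `n`-th jump. -/
lemma measure_inter_step [Countable S] [IsProbabilityMeasure P] (h : IsJumpHold P r x₀ Y H)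
    (he : ∀ x, 0 < exitRate r x) (hr : ∀ x y, 0 ≤ r x y) {n : ℕ} {x : S} (z : S) (u : ℝ) {A : Set Ω}
    (hA : MeasurableSet[history Y H n] A) (hAx : A ⊆ {ω | Y n ω = x}) :
    P (A ∩ ({ω | u < H n ω} ∩ {ω | Y (n + 1) ω = z})) =
      ENNReal.ofReal (Real.exp (-(exitRate r x * max u 0)) * (r x z / exitRate r x)) * P A := by
  have hle := h.history_le n
  set E : Set Ω := {ω | u < H n ω} ∩ {ω | Y (n + 1) ω = z} with hE
  set c : ℝ := Real.exp (-(exitRate r x * max u 0)) * (r x z / exitRate r x) with hc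
  have hc0 : 0 ≤ c := mul_nonneg (Real.exp_pos _).le (div_nonneg (hr _ _) (he _).le)
  have hEm : MeasurableSet E := (h.meas_H n measurableSet_Ioi).inter (h.meas_Y _ _)
  have hXm : MeasurableSet {ω | Y n ω = x} := h.meas_Y n x
  -- Both sides are finite measures on the history σ-algebra, so it suffices to compare them on
  -- cylinders.
  have key : (P.restrict ({ω | Y n ω = x} ∩ E)).trim hle =
      (ENNReal.ofReal c • P.restrict {ω | Y n ω = x}).trim hle := by
    -- A cylinder fixes a whole path, so the full space need not be one. It is covered by countably
    -- many: one for each finite path and each lower threshold `-m`.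
    refine Measure.ext_of_generateFrom_of_cover_subset (T := range fun w : (Fin (n + 1) → S) × ℕ =>
        cylinder Y H n (fun k => w.1 (Fin.ofNat (n + 1) k)) fun _ => -(w.2 : ℝ))
      (rfl : history Y H n = _) (isPiSystem_cylinder Y H n) ?_ (countable_range _) ?_ ?_ ?_
    · rintro _ ⟨w, rfl⟩
      exact ⟨(_, _), rfl⟩
    · refine eq_univ_of_forall fun ω => ?_
      obtain ⟨m, hm⟩ := exists_nat_gt (∑ k ∈ Finset.range n, |H k ω|)
      refine ⟨_, ⟨(fun i => Y i ω, m), rfl⟩, fun k hk => ?_, fun k hk => ?_⟩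
      · simp [Nat.mod_eq_of_lt (Nat.lt_succ_of_le hk)]
      · have h1 := Finset.single_le_sum (f := fun k => |H k ω|) (fun i _ => abs_nonneg _)
          (Finset.mem_range.2 hk)
        have h2 := neg_abs_le (H k ω)
        dsimp only at h1 ⊢
        linarith
    · rintro s -
      exact measure_ne_top _ _
    · rintro _ ⟨⟨y, v⟩, rfl⟩
      have hcy : MeasurableSet[history Y H n] (cylinder Y H n y v) :=
        MeasurableSpace.measurableSet_generateFrom ⟨(y, v), rfl⟩
      rw [trim_measurableSet_eq hle hcy, trim_measurableSet_eq hle hcy, Measure.smul_apply,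
        Measure.restrict_apply (hle _ hcy), Measure.restrict_apply (hle _ hcy), smul_eq_mul]
      by_cases hyx : y n = x
      swap
      · have h0 : cylinder Y H n y v ∩ {ω | Y n ω = x} = ∅ := by
          refine eq_empty_of_forall_notMem fun ω hω => hyx ?_
          rw [← hω.1.1 n le_rfl, hω.2]
        rw [← inter_assoc, h0, empty_inter, measure_empty, mul_zero]
      have h0 : cylinder Y H n y v ∩ {ω | Y n ω = x} = cylinder Y H n y v :=
        inter_eq_left.2 fun ω hω => (hω.1 n le_rfl).trans hyx
      rw [← inter_assoc, h0]
      by_cases hy : y 0 = x₀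
      swap
      · have hz : P (cylinder Y H n y v) = 0 := by
          refine measure_mono_null ?_ (ae_iff.1 h.ae_start)
          intro ω hω h2
          exact hy ((hω.1 0 (by omega)).symm.trans h2)
        rw [hz, mul_zero]
        exact measure_mono_null inter_subset_left hz
      have hne : ∀ k ≤ n, Function.update y (n + 1) z k = y k := fun k hk =>
        Function.update_of_ne (by omega) _ _
      have hnu : ∀ k < n, Function.update v n u k = v k := fun k hk =>
        Function.update_of_ne (by omega) _ _
      have hset : cylinder Y H n y v ∩ E =
          cylinder Y H (n + 1) (Function.update y (n + 1) z) (Function.update v n u) := by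
        ext ω
        simp only [hE, cylinder, mem_inter_iff, mem_ofPred_eq, Nat.forall_lt_succ_right,
          Nat.le_succ_iff, or_imp, forall_and, forall_eq, Function.update_self]
        constructor
        · rintro ⟨⟨a, b⟩, c, d⟩
          exact ⟨⟨fun k hk => (a k hk).trans (hne k hk).symm, d⟩,
            fun k hk => by rw [hnu k hk]; exact b k hk, c⟩
        · rintro ⟨⟨a, d⟩, b, c⟩
          exact ⟨⟨fun k hk => (a k hk).trans (hne k hk),
            fun k hk => by rw [← hnu k hk]; exact b k hk⟩, c, d⟩
      have hreal : P.real (cylinder Y H n y v ∩ E) = c * P.real (cylinder Y H n y v) := by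
        rw [hset, h.measureReal_cylinder he _ _ (by rw [hne 0 (by omega), hy]),
          h.measureReal_cylinder he _ _ hy, Finset.prod_range_succ, hne n le_rfl,
          Function.update_self, Function.update_self, hyx, ← hc, mul_comm]
        congr 1
        refine Finset.prod_congr rfl fun k hk => ?_
        rw [Finset.mem_range] at hk
        rw [hne k (by omega), hne (k + 1) (by omega), hnu k hk]
      rw [← ofReal_measureReal (μ := P) (s := cylinder Y H n y v ∩ E), hreal,
        ENNReal.ofReal_mul hc0, ofReal_measureReal]
  have := congrArg (fun m => m A) key
  rw [trim_measurableSet_eq hle hA, trim_measurableSet_eq hle hA, Measure.smul_apply,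
    Measure.restrict_apply (hle _ hA), Measure.restrict_apply (hle _ hA), smul_eq_mul,
    ← inter_assoc, inter_eq_left.2 hAx] at this
  exact this

end IsJumpHold
end MarkovStep
-- Exponential clocks and their exchange
section Exponential

lemma expMeasure_Ioi {e : ℝ} (he : 0 < e) (u : ℝ) :
    expMeasure e (Ioi u) = ENNReal.ofReal (Real.exp (-(e * max u 0))) := by
  have := isProbabilityMeasure_expMeasure he
  rw [← compl_Iic, prob_compl_eq_one_sub measurableSet_Iic, ← ofReal_cdf, cdf_expMeasure_eq he,
    ← ENNReal.ofReal_one, ← ENNReal.ofReal_sub _ (by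
      split_ifs with h
      · have : Real.exp (-(e * u)) ≤ 1 := Real.exp_le_one_iff.2 (by nlinarith)
        linarith
      · exact le_rfl)]
  split_ifs with h
  · rw [max_eq_left h, sub_sub_cancel]
  · rw [max_eq_right (not_le.1 h).le]; simp

/-- Survival function at time `τ` of an exponential clock of rate `e` started at time `0`. -/
noncomputable def survival (e τ : ℝ) : ENNReal :=
  if 0 ≤ τ then ENNReal.ofReal (Real.exp (-(e * τ))) else 0

lemma measurable_survival (e : ℝ) : Measurable (survival e) :=
  Measurable.ite measurableSet_Ici (by fun_prop) measurable_const

/-- Constancy of the hazard rate; this is what makes two consecutive clocks interchangeable. -/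
lemma exponentialPDF_eq_survival {e : ℝ} (he : 0 < e) (x : ℝ) :
    exponentialPDF e x = ENNReal.ofReal e * survival e x := by
  rw [exponentialPDF_eq, survival]
  split_ifs with h
  · rw [ENNReal.ofReal_mul he.le]
  · simp

lemma lintegral_expMeasure {e : ℝ} (he : 0 < e) {f : ℝ → ENNReal} (hf : Measurable f) :
    ∫⁻ x, f x ∂(expMeasure e) = ENNReal.ofReal e * ∫⁻ x, survival e x * f x := by
  have : expMeasure e = volume.withDensity (exponentialPDF e) := rfl
  have hm : Measurable (exponentialPDF e) := by
    rw [show exponentialPDF e = fun x => _ from funext (exponentialPDF_eq_survival he)]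
    exact (measurable_survival e).const_mul _
  rw [this, lintegral_withDensity_eq_lintegral_mul _ hm hf, ← lintegral_const_mul _
    (f := fun x => survival e x * f x) ((measurable_survival e).mul hf)]
  refine lintegral_congr fun x => ?_
  rw [Pi.mul_apply, exponentialPDF_eq_survival he, mul_assoc]

/-- Two consecutive exponential clocks, seen from the first or from the second one. -/
lemma lintegral_expMeasure_swap {e e' : ℝ} (he : 0 < e) (he' : 0 < e') (τ : ℝ)
    {G : ℝ × ℝ → ENNReal} (hG : Measurable G) :
    ENNReal.ofReal e⁻¹ * ∫⁻ h, survival e' (τ - h) * G (h, τ - h) ∂(expMeasure e) =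
      ENNReal.ofReal e'⁻¹ * ∫⁻ v, survival e (τ - v) * G (τ - v, v) ∂(expMeasure e') := by
  have hs := measurable_survival e
  have hs' := measurable_survival e'
  -- Once the rates are cancelled, both sides are the Lebesgue integral of `survival e h * survival
  -- e' (τ - h) * G (h, τ - h)`, up to the reflection `h = τ - v`.
  rw [lintegral_expMeasure he (by fun_prop), lintegral_expMeasure he' (by fun_prop), ← mul_assoc,
    ← mul_assoc, ← ENNReal.ofReal_mul (inv_pos.2 he).le, ← ENNReal.ofReal_mul (inv_pos.2 he').le,
    inv_mul_cancel₀ he.ne', inv_mul_cancel₀ he'.ne',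
    ← lintegral_sub_left_eq_self (fun x => survival e x * _) τ]
  congr 1
  refine lintegral_congr fun v => ?_
  rw [sub_sub_cancel]
  ring

lemma lintegral_exp_neg_expMeasure {e : ℝ} (he : 0 < e) :
    ∫⁻ x, ENNReal.ofReal (Real.exp (-x)) ∂(expMeasure e) = ENNReal.ofReal (e / (e + 1)) := by
  have he1 : 0 < e + 1 := by linarith
  rw [lintegral_expMeasure he (by fun_prop)]
  have h1 : ∀ x, survival e x * ENNReal.ofReal (Real.exp (-x)) = survival (e + 1) x := by
    intro x
    unfold survival
    split_ifs
    · rw [← ENNReal.ofReal_mul (Real.exp_pos _).le, ← Real.exp_add]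
      congr 2
      ring
    · simp
  have h2 := lintegral_exponentialPDF_eq_one he1
  simp_rw [exponentialPDF_eq_survival he1] at h2
  rw [lintegral_const_mul _ (measurable_survival _)] at h2
  simp_rw [h1]
  rw [div_eq_mul_inv, ENNReal.ofReal_mul he.le, ENNReal.ofReal_inv_of_pos he1]
  congr 1
  exact ENNReal.eq_inv_of_mul_eq_one_left ((mul_comm _ _).trans h2)

end Exponential

/-! ### Conditioning on the history, last-jump decomposition, non-explosion -/

section MarkovStep

variable {S Ω : Type*}

/-- The history is generated by cylinders that fix the whole path, so a condition on one state is
recovered as a countable union over finite paths and over thresholds `-m` low enough to impose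
nothing. -/
lemma measurableSet_history_jump [Countable S] {Y : ℕ → Ω → S} {H : ℕ → Ω → ℝ} {n k : ℕ}
    (hk : k ≤ n) (x : S) : MeasurableSet[history Y H n] {ω | Y k ω = x} := by
  have : {ω | Y k ω = x} = ⋃ w : {w : (Fin (n + 1) → S) × ℕ // w.1 (Fin.ofNat (n + 1) k) = x},
      cylinder Y H n (fun k => w.1.1 (Fin.ofNat (n + 1) k)) fun _ => -(w.1.2 : ℝ) := by
    ext ω
    simp only [mem_ofPred_eq, mem_iUnion]
    constructor
    · intro hω
      obtain ⟨m, hm⟩ := exists_nat_gt (∑ k ∈ Finset.range n, |H k ω|)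
      refine ⟨⟨(fun i => Y i ω, m), ?_⟩, fun k hk => ?_, fun k hk => ?_⟩
      · simpa [Nat.mod_eq_of_lt (Nat.lt_succ_of_le hk)] using hω
      · simp [Nat.mod_eq_of_lt (Nat.lt_succ_of_le hk)]
      · have h1 := Finset.single_le_sum (f := fun k => |H k ω|) (fun i _ => abs_nonneg _)
          (Finset.mem_range.2 hk)
        have h2 := neg_abs_le (H k ω)
        dsimp only at h1 ⊢
        linarith
    · rintro ⟨⟨w, hw⟩, hω⟩
      exact (hω.1 k hk).trans hw
  rw [this]
  exact MeasurableSet.iUnion fun w => MeasurableSpace.measurableSet_generateFrom ⟨(_, _), rfl⟩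

lemma measurable_history_hold [Countable S] {Y : ℕ → Ω → S} {H : ℕ → Ω → ℝ} {n k : ℕ}
    (hk : k < n) : Measurable[history Y H n] (H k) := by
  refine measurable_of_Ioi fun u => ?_
  have : H k ⁻¹' Ioi u = ⋃ w : (Fin (n + 1) → S) × ℕ,
      cylinder Y H n (fun k => w.1 (Fin.ofNat (n + 1) k))
        (Function.update (fun _ => -(w.2 : ℝ)) k u) := by
    ext ω
    simp only [mem_preimage, mem_Ioi, mem_iUnion]
    constructor
    · intro hω
      obtain ⟨m, hm⟩ := exists_nat_gt (∑ k ∈ Finset.range n, |H k ω|)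
      refine ⟨(fun i => Y i ω, m), fun j hj => ?_, fun j hj => ?_⟩
      · simp [Nat.mod_eq_of_lt (Nat.lt_succ_of_le hj)]
      · rcases eq_or_ne j k with rfl | hjk
        · simpa using hω
        rw [Function.update_of_ne hjk]
        have h1 := Finset.single_le_sum (f := fun k => |H k ω|) (fun i _ => abs_nonneg _)
          (Finset.mem_range.2 hj)
        have h2 := neg_abs_le (H j ω)
        dsimp only at h1 ⊢
        linarith
    · rintro ⟨w, hω⟩
      simpa using hω.2 k hk
  rw [this]
  exact MeasurableSet.iUnion fun w => MeasurableSpace.measurableSet_generateFrom ⟨(_, _), rfl⟩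

lemma history_mono [Countable S] (Y : ℕ → Ω → S) (H : ℕ → Ω → ℝ) : Monotone (history Y H) := by
  intro m n hmn
  refine MeasurableSpace.generateFrom_le ?_
  rintro _ ⟨z, rfl⟩
  exact measurableSet_cylinder_of (fun k hk => measurableSet_history_jump (hk.trans hmn))
    (fun k hk => measurable_history_hold (hk.trans_le hmn)) _ _

/-- The time of the `n`-th jump. -/
noncomputable def jumpTime (H : ℕ → Ω → ℝ) (n : ℕ) (ω : Ω) : ℝ := ∑ k ∈ Finset.range n, H k ω

lemma jumpTime_succ (H : ℕ → Ω → ℝ) (n : ℕ) (ω : Ω) :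
    jumpTime H (n + 1) ω = jumpTime H n ω + H n ω := Finset.sum_range_succ _ _

lemma measurable_history_jumpTime [Countable S] (Y : ℕ → Ω → S) (H : ℕ → Ω → ℝ) (n : ℕ) :
    Measurable[history Y H n] (jumpTime H n) :=
  Finset.measurable_fun_sum _ fun _ hk => measurable_history_hold (Finset.mem_range.1 hk)

/-- The event that exactly `n` jumps have occurred by time `t`. -/
def window (H : ℕ → Ω → ℝ) (n : ℕ) (t : ℝ) : Set Ω :=
  {ω | jumpTime H n ω ≤ t ∧ t < jumpTime H (n + 1) ω}

variable [MeasurableSpace Ω] {P : Measure Ω} {r : S → S → ℝ} {x₀ : S} {Y : ℕ → Ω → S}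
  {H : ℕ → Ω → ℝ} {E : Type*} [MeasurableSpace E]

namespace IsJumpHold

lemma measurable_jumpTime (h : IsJumpHold P r x₀ Y H) (n : ℕ) : Measurable (jumpTime H n) :=
  Finset.measurable_fun_sum _ fun k _ => h.meas_H k

lemma measurableSet_window (h : IsJumpHold P r x₀ Y H) (n : ℕ) (t : ℝ) :
    MeasurableSet (window H n t) :=
  (measurableSet_le (h.measurable_jumpTime n) measurable_const).inter
    (measurableSet_lt measurable_const (h.measurable_jumpTime (n + 1)))

/-- `measure_inter_step` gives the tail of `H n` on every history event, and tails determine a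
finite measure on the line; measurable rectangles then determine the joint law. -/
lemma map_prod_hold [Countable S] [IsProbabilityMeasure P] (h : IsJumpHold P r x₀ Y H)
    (he : ∀ x, 0 < exitRate r x) (hr : ∀ x y, 0 ≤ r x y) {n : ℕ} {x : S} (z : S) {A : Set Ω}
    (hA : MeasurableSet[history Y H n] A) (hAx : A ⊆ {ω | Y n ω = x})
    {Z : Ω → E} (hZ : Measurable[history Y H n] Z) :
    (P.restrict (A ∩ {ω | Y (n + 1) ω = z})).map (fun ω => (Z ω, H n ω)) =
      ENNReal.ofReal (r x z / exitRate r x) •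
        ((P.restrict A).map Z).prod (expMeasure (exitRate r x)) := by
  have := isProbabilityMeasure_expMeasure (he x)
  have hle := h.history_le n
  have hZm : Measurable Z := hZ.mono hle le_rfl
  have hHm := h.meas_H n
  refine Measure.ext_prod fun {s t} hs ht => ?_
  have hB : MeasurableSet[history Y H n] (Z ⁻¹' s ∩ A) := (hZ hs).inter hA
  have key : (P.restrict ((Z ⁻¹' s ∩ A) ∩ {ω | Y (n + 1) ω = z})).map (H n) =
      (ENNReal.ofReal (r x z / exitRate r x) * P (Z ⁻¹' s ∩ A)) • expMeasure (exitRate r x) := by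
    have hIoi : ∀ u, (P.restrict ((Z ⁻¹' s ∩ A) ∩ {ω | Y (n + 1) ω = z})).map (H n) (Ioi u) =
      ((ENNReal.ofReal (r x z / exitRate r x) * P (Z ⁻¹' s ∩ A)) •
        expMeasure (exitRate r x)) (Ioi u) := by
      intro u
      rw [Measure.map_apply hHm measurableSet_Ioi, Measure.restrict_apply (hHm measurableSet_Ioi),
        Measure.smul_apply, expMeasure_Ioi (he x), smul_eq_mul]
      have h1 := h.measure_inter_step he hr z u hB (inter_subset_right.trans hAx)
      rw [ENNReal.ofReal_mul (Real.exp_pos _).le] at h1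
      rw [show H n ⁻¹' Ioi u ∩ ((Z ⁻¹' s ∩ A) ∩ {ω | Y (n + 1) ω = z}) =
        (Z ⁻¹' s ∩ A) ∩ ({ω | u < H n ω} ∩ {ω | Y (n + 1) ω = z}) from by
          ext ω; simp only [mem_inter_iff, mem_preimage, mem_Ioi, mem_ofPred_eq]; tauto, h1]
      ring
    have hfin : IsFiniteMeasure ((ENNReal.ofReal (r x z / exitRate r x) * P (Z ⁻¹' s ∩ A)) •
        expMeasure (exitRate r x)) :=
      Measure.smul_finite _ (ENNReal.mul_ne_top ENNReal.ofReal_ne_top (measure_ne_top _ _))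
    refine Measure.ext_of_Ioc _ _ fun a b hab => ?_
    rw [← Ioi_sdiff_Ioi, measure_sdiff (Ioi_subset_Ioi hab.le)
      measurableSet_Ioi.nullMeasurableSet (measure_ne_top _ _),
      measure_sdiff (Ioi_subset_Ioi hab.le)
      measurableSet_Ioi.nullMeasurableSet (measure_ne_top _ _), hIoi, hIoi]
  have h2 := congrArg (fun m => m t) key
  simp only [Measure.smul_apply, smul_eq_mul] at h2
  rw [Measure.map_apply hHm ht, Measure.restrict_apply (hHm ht)] at h2
  rw [Measure.map_apply (hZm.prodMk hHm) (hs.prod ht),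
    Measure.restrict_apply ((hZm.prodMk hHm) (hs.prod ht)), Measure.smul_apply, Measure.prod_prod,
    Measure.map_apply hZm hs, Measure.restrict_apply (hZm hs), smul_eq_mul, ← mul_assoc, ← h2]
  congr 1
  ext ω
  simp only [mem_inter_iff, mem_preimage, mem_prod]
  tauto

/-- Given the history, the next holding time is exponential and independent of the next state. -/
lemma lintegral_step [Countable S] [IsProbabilityMeasure P] (h : IsJumpHold P r x₀ Y H)
    (he : ∀ x, 0 < exitRate r x) (hr : ∀ x y, 0 ≤ r x y) {n : ℕ} {x : S} (z : S) {A : Set Ω}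
    (hA : MeasurableSet[history Y H n] A) (hAx : A ⊆ {ω | Y n ω = x})
    {Z : Ω → E} (hZ : Measurable[history Y H n] Z) {Φ : E × ℝ → ENNReal} (hΦ : Measurable Φ) :
    ∫⁻ ω in A ∩ {ω | Y (n + 1) ω = z}, Φ (Z ω, H n ω) ∂P =
      ENNReal.ofReal (r x z / exitRate r x) *
        ∫⁻ ω in A, ∫⁻ s, Φ (Z ω, s) ∂(expMeasure (exitRate r x)) ∂P := by
  have := isProbabilityMeasure_expMeasure (he x)
  have hZm : Measurable Z := hZ.mono (h.history_le n) le_rfl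
  rw [← lintegral_map (f := Φ) hΦ (hZm.prodMk (h.meas_H n)), h.map_prod_hold he hr z hA hAx hZ,
    lintegral_smul_measure, lintegral_prod _ hΦ.aemeasurable, lintegral_map _ hZm, smul_eq_mul]
  exact hΦ.lintegral_prod_right'

lemma tsum_ofReal_rate_div {x : S} (he : 0 < exitRate r x) (hr : ∀ x y, 0 ≤ r x y) :
    ∑' z, ENNReal.ofReal (r x z / exitRate r x) = 1 := by
  -- A non-summable family has `tsum` equal to 0, so a positive exit rate forces summability.
  have hs : Summable (r x) := by
    by_contra hcon
    exact he.ne' (tsum_eq_zero_of_not_summable hcon)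
  rw [← ENNReal.ofReal_tsum_of_nonneg (fun z => div_nonneg (hr _ _) he.le) (hs.div_const _),
    tsum_div_const, show ∑' z, r x z = exitRate r x from rfl, div_self he.ne', ENNReal.ofReal_one]

lemma lintegral_hold [Countable S] [IsProbabilityMeasure P] (h : IsJumpHold P r x₀ Y H)
    (he : ∀ x, 0 < exitRate r x) (hr : ∀ x y, 0 ≤ r x y) {n : ℕ} {x : S} {A : Set Ω}
    (hA : MeasurableSet[history Y H n] A) (hAx : A ⊆ {ω | Y n ω = x})
    {Z : Ω → E} (hZ : Measurable[history Y H n] Z) {Φ : E × ℝ → ENNReal} (hΦ : Measurable Φ) :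
    ∫⁻ ω in A, Φ (Z ω, H n ω) ∂P =
      ∫⁻ ω in A, ∫⁻ s, Φ (Z ω, s) ∂(expMeasure (exitRate r x)) ∂P := by
  rw [lintegral_eq_tsum_fiber (h.meas_Y (n + 1)) (P.restrict A)]
  have : ∀ z, ∫⁻ ω in {ω | Y (n + 1) ω = z}, Φ (Z ω, H n ω) ∂(P.restrict A) =
      ENNReal.ofReal (r x z / exitRate r x) *
        ∫⁻ ω in A, ∫⁻ s, Φ (Z ω, s) ∂(expMeasure (exitRate r x)) ∂P := by
    intro z
    rw [Measure.restrict_restrict (h.meas_Y _ _), inter_comm, h.lintegral_step he hr z hA hAx hZ hΦ]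
  rw [tsum_congr this, ENNReal.tsum_mul_right, tsum_ofReal_rate_div (he x) hr, one_mul]

/-- Once the `n`-th jump has occurred by time `t`, no further jump has happened exactly when the
current holding time exceeds `t - jumpTime H n`; integrating it out leaves the survival function. -/
lemma lintegral_window [Countable S] [IsProbabilityMeasure P] (h : IsJumpHold P r x₀ Y H)
    (he : ∀ x, 0 < exitRate r x) (hr : ∀ x y, 0 ≤ r x y) {n : ℕ} {x : S} {A : Set Ω}
    (hA : MeasurableSet[history Y H n] A) (hAx : A ⊆ {ω | Y n ω = x})
    {Z : Ω → E} (hZ : Measurable[history Y H n] Z) {Φ : E → ENNReal} (hΦ : Measurable Φ) (t : ℝ) :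
    ∫⁻ ω in A ∩ window H n t, Φ (Z ω) ∂P =
      ∫⁻ ω in A, survival (exitRate r x) (t - jumpTime H n ω) * Φ (Z ω) ∂P := by
  have hw := h.measurableSet_window n t
  have hS := measurable_history_jumpTime Y H n
  let Ψ : (E × ℝ) × ℝ → ENNReal := fun w =>
    {w : (E × ℝ) × ℝ | w.1.2 ≤ t ∧ t < w.1.2 + w.2}.indicator
    (fun w => Φ w.1.1) w
  have hΨ : Measurable Ψ := by
    refine Measurable.indicator (by fun_prop) ?_
    exact (measurableSet_le (f := fun w : (E × ℝ) × ℝ => w.1.2) (by fun_prop)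
      measurable_const).inter (measurableSet_lt (g := fun w : (E × ℝ) × ℝ => w.1.2 + w.2)
        measurable_const (by fun_prop))
  have h1 := h.lintegral_hold he hr hA hAx (hZ.prodMk hS) hΨ
  rw [inter_comm, ← Measure.restrict_restrict hw, ← lintegral_indicator hw]
  refine Eq.trans (lintegral_congr fun ω => ?_) (h1.trans (lintegral_congr fun ω => ?_))
  · simp only [Ψ, indicator, window, jumpTime_succ, mem_ofPred_eq]
  · simp only [survival, sub_nonneg]
    split_ifs with hle
    · have : ∀ s, Ψ ((Z ω, jumpTime H n ω), s) =
          (Ioi (t - jumpTime H n ω)).indicator (fun _ => Φ (Z ω)) s := by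
        intro s
        simp only [Ψ, indicator, mem_ofPred_eq, hle, true_and, mem_Ioi, sub_lt_iff_lt_add']
      rw [lintegral_congr this, lintegral_indicator measurableSet_Ioi, setLIntegral_const,
        expMeasure_Ioi (he x), max_eq_left (sub_nonneg.2 hle), mul_comm]
    · have : ∀ s, Ψ ((Z ω, jumpTime H n ω), s) = 0 := by
        intro s
        simp only [Ψ, indicator, mem_ofPred_eq, hle, false_and, if_false]
      simp [lintegral_congr this]

/-- Decomposition with respect to the age `v` of the current visit. -/
lemma lintegral_last_jump [Countable S] [IsProbabilityMeasure P] (h : IsJumpHold P r x₀ Y H)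
    (he : ∀ x, 0 < exitRate r x) (hr : ∀ x y, 0 ≤ r x y) {n : ℕ} {x : S} (z : S) {A : Set Ω}
    (hA : MeasurableSet[history Y H n] A) (hAx : A ⊆ {ω | Y n ω = x})
    {Z : Ω → E} (hZ : Measurable[history Y H n] Z) {G : E × ℝ × ℝ → ENNReal} (hG : Measurable G)
    (t : ℝ) :
    ∫⁻ ω in (A ∩ {ω | Y (n + 1) ω = z}) ∩ window H (n + 1) t,
        G (Z ω, H n ω, t - jumpTime H (n + 1) ω) ∂P =
      ENNReal.ofReal (r x z / exitRate r z) *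
        ∫⁻ v, ∫⁻ ω in A ∩ window H n (t - v), G (Z ω, t - v - jumpTime H n ω, v) ∂P
          ∂(expMeasure (exitRate r z)) := by
  have := isProbabilityMeasure_expMeasure (he z)
  have hmono : history Y H n ≤ history Y H (n + 1) := history_mono Y H (Nat.le_succ n)
  have hsx := measurable_survival (exitRate r x)
  have hsz := measurable_survival (exitRate r z)
  have hS := measurable_history_jumpTime Y H n
  have hS' := measurable_history_jumpTime Y H (n + 1)
  have hSm := h.measurable_jumpTime n
  have hZm : Measurable Z := hZ.mono (h.history_le n) le_rfl
  have hZ' : Measurable[history Y H (n + 1)] Z := hZ.mono hmono le_rfl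
  have hHn : Measurable[history Y H (n + 1)] (H n) := measurable_history_hold (Nat.lt_succ_self n)
  -- Integrating out the unfinished holding time in `z` produces its survival factor.
  rw [h.lintegral_window he hr (Z := fun ω => (Z ω, H n ω, jumpTime H (n + 1) ω))
    (Φ := fun w => G (w.1, w.2.1, t - w.2.2)) (x := z)
    ((hmono _ hA).inter (measurableSet_history_jump le_rfl z)) inter_subset_right
    (hZ'.prodMk (hHn.prodMk hS')) (by fun_prop)]
  have hstep := h.lintegral_step he hr z hA hAx (hZ.prodMk hS)
    (Φ := fun w => survival (exitRate r z) (t - (w.1.2 + w.2)) *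
      G (w.1.1, w.2, t - (w.1.2 + w.2))) (by fun_prop)
  simp only [← jumpTime_succ] at hstep
  rw [hstep]
  -- The exchange of clocks: the age `v` in `z` becomes the exponential variable, and the survival
  -- factor now belongs to `x`. Trading the inverse rates turns the constant `r x z / exitRate r x`
  -- into `r x z / exitRate r z`.
  have hswap : ∀ ω, ENNReal.ofReal (exitRate r x)⁻¹ *
      ∫⁻ s, survival (exitRate r z) (t - (jumpTime H n ω + s)) *
        G (Z ω, s, t - (jumpTime H n ω + s)) ∂(expMeasure (exitRate r x)) =
      ENNReal.ofReal (exitRate r z)⁻¹ *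
      ∫⁻ v, survival (exitRate r x) (t - v - jumpTime H n ω) *
        G (Z ω, t - v - jumpTime H n ω, v) ∂(expMeasure (exitRate r z)) := by
    intro ω
    have := lintegral_expMeasure_swap (he x) (he z) (t - jumpTime H n ω)
      (G := fun w => G (Z ω, w.1, w.2)) (by fun_prop)
    simp only [← sub_sub]
    simp only [sub_right_comm t _ (jumpTime H n ω)] at this ⊢
    exact this
  have hm1 : Measurable fun ω => ∫⁻ s, survival (exitRate r z) (t - (jumpTime H n ω + s)) *
        G (Z ω, s, t - (jumpTime H n ω + s)) ∂(expMeasure (exitRate r x)) := by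
    have := isProbabilityMeasure_expMeasure (he x)
    exact Measurable.lintegral_prod_right' (f := fun w : Ω × ℝ =>
      survival (exitRate r z) (t - (jumpTime H n w.1 + w.2)) *
        G (Z w.1, w.2, t - (jumpTime H n w.1 + w.2))) (by fun_prop)
  have hm2 : Measurable fun ω => ∫⁻ v, survival (exitRate r x) (t - v - jumpTime H n ω) *
        G (Z ω, t - v - jumpTime H n ω, v) ∂(expMeasure (exitRate r z)) :=
    Measurable.lintegral_prod_right' (f := fun w : Ω × ℝ =>
      survival (exitRate r x) (t - w.2 - jumpTime H n w.1) *
        G (Z w.1, t - w.2 - jumpTime H n w.1, w.2)) (by fun_prop)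
  rw [div_eq_mul_inv, div_eq_mul_inv, ENNReal.ofReal_mul (hr x z), ENNReal.ofReal_mul (hr x z),
    mul_assoc, mul_assoc, ← lintegral_const_mul _ hm1, lintegral_congr hswap,
    lintegral_const_mul _ hm2, lintegral_lintegral_swap (by fun_prop)]
  congr 2
  refine lintegral_congr fun v => ?_
  -- The survival factor of `x` is read backwards as the event that exactly `n` jumps have occurred
  -- by time `t - v`.
  rw [h.lintegral_window he hr hA hAx (Z := fun ω => (Z ω, jumpTime H n ω))
    (Φ := fun w => G (w.1, t - v - w.2, v)) (hZ.prodMk hS) (by fun_prop)]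

/-- Given the history, an exponential time of rate `e` contributes its Laplace transform `e / (e +
1)`, which is at most `M / (M + 1)`. -/
lemma lintegral_exp_neg_jumpTime_le [Countable S] [IsProbabilityMeasure P]
    (h : IsJumpHold P r x₀ Y H) (he : ∀ x, 0 < exitRate r x) (hr : ∀ x y, 0 ≤ r x y) {M : ℝ}
    (hM : ∀ x, exitRate r x ≤ M) (n : ℕ) :
    ∫⁻ ω, ENNReal.ofReal (Real.exp (-jumpTime H n ω)) ∂P ≤ ENNReal.ofReal (M / (M + 1)) ^ n := by
  induction n with
  | zero => simp [jumpTime]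
  | succ n ih =>
    rw [pow_succ]
    refine le_trans ?_ (mul_le_mul_left ih _)
    rw [lintegral_eq_tsum_fiber (h.meas_Y n), lintegral_eq_tsum_fiber (h.meas_Y n),
      ← ENNReal.tsum_mul_right]
    refine ENNReal.tsum_le_tsum fun x => ?_
    have hm := h.measurable_jumpTime n
    have h1 := h.lintegral_hold he hr (A := {ω | Y n ω = x}) (measurableSet_history_jump le_rfl x)
      subset_rfl (measurable_history_jumpTime Y H n)
      (Φ := fun w => ENNReal.ofReal (Real.exp (-w.1)) * ENNReal.ofReal (Real.exp (-w.2)))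
      (by fun_prop)
    rw [show (fun ω => ENNReal.ofReal (Real.exp (-jumpTime H (n + 1) ω))) = fun ω =>
      ENNReal.ofReal (Real.exp (-jumpTime H n ω)) * ENNReal.ofReal (Real.exp (-H n ω)) from by
        funext ω
        rw [jumpTime_succ, neg_add, Real.exp_add, ENNReal.ofReal_mul (Real.exp_pos _).le], h1,
      ← lintegral_mul_const _ (by fun_prop)]
    refine lintegral_mono fun ω => ?_
    dsimp only
    rw [lintegral_const_mul _ (by fun_prop), lintegral_exp_neg_expMeasure (he x)]
    have := he x
    have := hM x
    refine mul_le_mul_right (ENNReal.ofReal_le_ofReal ?_) _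
    rw [div_le_div_iff₀ (by linarith) (by linarith)]
    nlinarith

/-- Bounded exit rates: the chain does not explode. -/
lemma ae_exists_lt_jumpTime [Countable S] [IsProbabilityMeasure P]
    (h : IsJumpHold P r x₀ Y H) (he : ∀ x, 0 < exitRate r x) (hr : ∀ x y, 0 ≤ r x y) {M : ℝ}
    (hM : ∀ x, exitRate r x ≤ M) : ∀ᵐ ω ∂P, ∀ t : ℝ, ∃ n, t < jumpTime H n ω := by
  suffices ∀ m : ℕ, ∀ᵐ ω ∂P, ∃ n, (m : ℝ) < jumpTime H n ω by
    filter_upwards [ae_all_iff.2 this] with ω hω t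
    obtain ⟨m, hm⟩ := exists_nat_gt t
    obtain ⟨n, hn⟩ := hω m
    exact ⟨n, hm.trans hn⟩
  intro m
  have hM0 : 0 < M := (he x₀).trans_le (hM x₀)
  rw [ae_iff]
  -- Markov's inequality for `exp (-jumpTime H n)`, with `n` arbitrary: if all jump times stay below
  -- `m`, this variable is at least `exp (-m)` for every `n`.
  refine le_antisymm (ge_of_tendsto' (x := atTop) (f := fun n : ℕ =>
    ENNReal.ofReal (M / (M + 1)) ^ n / ENNReal.ofReal (Real.exp (-m))) ?_ fun n => ?_) bot_le
  · have : Tendsto (fun n : ℕ => ENNReal.ofReal (M / (M + 1)) ^ n) atTop (𝓝 0) := by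
      apply ENNReal.tendsto_pow_atTop_nhds_zero_of_lt_one
      rw [ENNReal.ofReal_lt_one, div_lt_one (by linarith)]
      linarith
    simpa using ENNReal.Tendsto.div_const this (Or.inr (by simp [Real.exp_pos]))
  · refine le_trans (measure_mono ?_) (le_trans (meas_ge_le_lintegral_div
      (f := fun ω => ENNReal.ofReal (Real.exp (-jumpTime H n ω))) (by
        have := h.measurable_jumpTime n
        fun_prop) (by simp [Real.exp_pos]) ENNReal.ofReal_ne_top)
      (ENNReal.div_le_div_right (h.lintegral_exp_neg_jumpTime_le he hr hM n) _))
    intro ω hω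
    simp only [mem_ofPred_eq, not_exists, not_lt] at hω ⊢
    gcongr
    exact hω n

/-- Almost surely, only transitions of positive rate occur. -/
lemma ae_rate_ne_zero [Countable S] [IsProbabilityMeasure P] (h : IsJumpHold P r x₀ Y H)
    (he : ∀ x, 0 < exitRate r x) (hr : ∀ x y, 0 ≤ r x y) :
    ∀ᵐ ω ∂P, ∀ n, r (Y n ω) (Y (n + 1) ω) ≠ 0 := by
  refine ae_all_iff.2 fun n => ?_
  have : ∀ x z, r x z = 0 → ∀ᵐ ω ∂P, ¬(Y n ω = x ∧ Y (n + 1) ω = z) := by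
    intro x z hxz
    -- Any negative threshold makes the condition on the holding time void almost surely.
    have h1 := h.measure_inter_step he hr z (-1) (A := {ω | Y n ω = x})
      (measurableSet_history_jump le_rfl x) subset_rfl
    rw [hxz, zero_div, mul_zero, ENNReal.ofReal_zero, zero_mul] at h1
    filter_upwards [h.ae_hold_pos he, compl_mem_ae_iff.2 h1] with ω hω h2 h3
    exact h2 ⟨h3.1, show -1 < H n ω by linarith [hω n], h3.2⟩
  have h2 : ∀ᵐ ω ∂P, ∀ x z, r x z = 0 → ¬(Y n ω = x ∧ Y (n + 1) ω = z) :=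
    ae_all_iff.2 fun x => ae_all_iff.2 fun z => by
      by_cases hxz : r x z = 0
      · filter_upwards [this x z hxz] with ω hω _ using hω
      · exact Eventually.of_forall fun ω h3 => absurd h3 hxz
  filter_upwards [h2] with ω hω h0
  exact hω _ _ h0 ⟨rfl, rfl⟩

end IsJumpHold
end MarkovStep
-- Level times of a deterministic jump path
section Path

/-- The path `f` takes the value `y n` between the jump times `T n` and `T (n + 1)`. -/
structure IsJumpPath {S : Type*} (y : ℕ → S) (T : ℕ → ℝ≥0) (f : ℝ≥0 → S) : Prop where
  zero : T 0 = 0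
  mono : StrictMono T
  unbounded : ∀ t, ∃ n, t < T n
  eq : ∀ n t, T n ≤ t → t < T (n + 1) → f t = y n

namespace IsJumpPath

variable {y : ℕ → Option ℕ} {T : ℕ → ℝ≥0} {f : ℝ≥0 → Option ℕ}

lemma exists_index {S : Type*} {y : ℕ → S} {f : ℝ≥0 → S} (h : IsJumpPath y T f) (t : ℝ≥0) :
    ∃ n, T n ≤ t ∧ t < T (n + 1) := by
  classical
  have hex := h.unbounded t
  have h0 : Nat.find hex ≠ 0 := fun h0 => by
    have := Nat.find_spec hex
    rw [h0, h.zero] at this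
    exact not_lt_bot this
  obtain ⟨n, hn⟩ := Nat.exists_eq_succ_of_ne_zero h0
  refine ⟨n, not_lt.1 (Nat.find_min hex (by omega)), ?_⟩
  rw [← Nat.succ_eq_add_one, ← hn]
  exact Nat.find_spec hex

/-- The minimum covers both cases: a visit still in progress ends at `t`, while a completed one ends
at `T (k + 1)`, a supremum that is not attained. -/
lemma visitEnd_eq (h : IsJumpPath y T f) {t : ℝ≥0} {N k j : ℕ} (h1 : T N ≤ t) (h2 : t < T (N + 1))
    (hk : k ≤ N) (hy : y k = some j) (hlast : ∀ l, k < l → l ≤ N → y l ≠ some j) :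
    visitEnd f t j = min (T (k + 1)) t := by
  have hTk : T k ≤ t := (h.mono.monotone hk).trans h1
  have hval : ∀ u, T k ≤ u → u < T (k + 1) → f u = some j := fun u a b => (h.eq k u a b).trans hy
  refine IsLUB.csSup_eq ⟨?_, ?_⟩ ⟨T k, hTk, hval _ le_rfl (h.mono (Nat.lt_succ_self k))⟩
  · rintro u ⟨hu, hfu⟩
    refine le_min ?_ hu
    obtain ⟨n, hn1, hn2⟩ := h.exists_index u
    have hnN : n ≤ N := by
      by_contra hcon
      exact absurd (h2.trans_le ((h.mono.monotone (by omega)).trans (hn1.trans hu)))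
        (lt_irrefl _)
    have hnk : n ≤ k := by
      by_contra hcon
      exact hlast n (by omega) hnN ((h.eq n u hn1 hn2).symm.trans hfu)
    exact hn2.le.trans (h.mono.monotone (by omega))
  · intro w hw
    by_contra hcon
    rw [not_le] at hcon
    rcases lt_or_ge t (T (k + 1)) with htk | htk
    · rw [min_eq_right htk.le] at hcon
      exact absurd (hw ⟨le_rfl, hval t hTk htk⟩) (not_le.2 hcon)
    · rw [min_eq_left htk] at hcon
      obtain ⟨u, hu1, hu2⟩ := exists_between (max_lt hcon (h.mono (Nat.lt_succ_self k)))
      have := hw ⟨hu2.le.trans htk, hval u ((le_max_right _ _).trans hu1.le) hu2⟩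
      exact absurd ((le_max_left _ _).trans_lt hu1) (not_lt.2 this)

/-- Just before `T (k + 1)` the path sits at `y k`, which differs from level `j`, so the constancy
interval cannot be extended to the left. -/
lemma visitStart_eq (h : IsJumpPath y T f) {t : ℝ≥0} {N k j : ℕ} (h1 : T N ≤ t)
    (h2 : t < T (N + 1)) (hk : k + 1 ≤ N) (hy : y (k + 1) = some j)
    (hlast : ∀ l, k + 1 < l → l ≤ N → y l ≠ some j) (hprev : y k ≠ some j) :
    visitStart f t j = T (k + 1) := by
  have hTk : T (k + 1) ≤ t := (h.mono.monotone hk).trans h1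
  rw [visitStart, h.visitEnd_eq h1 h2 hk hy hlast]
  have hTe : T (k + 1) ≤ min (T (k + 1 + 1)) t := le_min (h.mono.monotone (by omega)) hTk
  refine IsLeast.csInf_eq ⟨⟨hTe, fun v hv1 hv2 => ?_⟩, ?_⟩
  · exact (h.eq (k + 1) v hv1 (hv2.trans_le (min_le_left _ _))).trans hy
  · rintro u ⟨-, hu⟩
    by_contra hcon
    rw [not_le] at hcon
    have hlt : max u (T k) < T (k + 1) := max_lt hcon (h.mono (Nat.lt_succ_self k))
    have h3 := hu _ (le_max_left u (T k)) (hlt.trans_le hTe)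
    rw [h.eq k _ (le_max_right _ _) hlt] at h3
    exact hprev h3

/-- On a path that has climbed from `none` to level `i` since the `m`-th jump, the level times are
the last `i` holding times and the age of the current visit. -/
lemma levelTimes_eq (h : IsJumpPath y T f) {t : ℝ≥0} {m i : ℕ} (h0 : y m = none)
    (hy : ∀ j ≤ i, y (m + 1 + j) = some j) (h1 : T (m + 1 + i) ≤ t) (h2 : t < T (m + 1 + i + 1)) :
    levelTimes f t i = Fin.snoc (α := fun _ => ℝ)
      (fun j : Fin i => (T (m + 1 + j + 1) : ℝ) - T (m + 1 + j)) ((t : ℝ) - T (m + 1 + i)) := by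
  funext j
  have hj : (j : ℕ) ≤ i := Nat.lt_succ_iff.1 j.2
  have hy' : y (m + j + 1) = some (j : ℕ) := by
    rw [← hy j hj]; congr 1; omega
  have hlast : ∀ l, m + j + 1 < l → l ≤ m + 1 + i → y l ≠ some (j : ℕ) := by
    intro l hl1 hl2
    obtain ⟨d, rfl⟩ : ∃ d, l = m + 1 + d := ⟨l - (m + 1), by omega⟩
    rw [hy d (by omega)]
    intro hcon
    have := Option.some.inj hcon
    omega
  have hprev : y (m + j) ≠ some (j : ℕ) := by
    rcases Nat.eq_zero_or_pos (j : ℕ) with hj0 | hj0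
    · rw [hj0, add_zero, h0]; simp
    · rw [show m + (j : ℕ) = m + 1 + (j - 1) by omega, hy _ (by omega)]
      intro hcon
      have := Option.some.inj hcon
      omega
  have hk : m + (j : ℕ) + 1 ≤ m + 1 + i := by omega
  rw [levelTimes, h.visitStart_eq h1 h2 hk hy' hlast hprev, h.visitEnd_eq h1 h2 hk hy' hlast]
  clear hy' hlast hprev hk hj
  induction j using Fin.lastCases with
  | last =>
    rw [Fin.snoc_last, Fin.val_last, show m + i + 1 = m + 1 + i by omega, min_eq_right h2.le]
  | cast j =>
    rw [Fin.snoc_castSucc, Fin.val_castSucc, show m + (j : ℕ) + 1 = m + 1 + j by omega,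
      min_eq_left ((h.mono.monotone (by omega)).trans h1)]

end IsJumpPath

lemma rate_some_ne_zero {lam mu q p : ℝ} {x : Option ℕ} {i : ℕ}
    (h : rate lam mu q p x (some i) ≠ 0) :
    (x = none ∧ i = 0) ∨ ∃ j, x = some j ∧ i = j + 1 := by
  cases x with
  | none => left; exact ⟨rfl, by by_contra hcon; exact h (by simp [rate, hcon])⟩
  | some j => right; exact ⟨j, rfl, by by_contra hcon; exact h (by simp [rate, hcon])⟩

/-- A path that is at level `i` has climbed there from `none`. -/
lemma exists_climb {lam mu q p : ℝ} {y : ℕ → Option ℕ} (h0 : y 0 = none)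
    (hr : ∀ n, rate lam mu q p (y n) (y (n + 1)) ≠ 0) {i n : ℕ} (hn : y n = some i) :
    ∃ m, n = m + 1 + i ∧ y m = none ∧ ∀ j ≤ i, y (m + 1 + j) = some j := by
  induction i generalizing n with
  | zero =>
    obtain ⟨k, rfl⟩ := Nat.exists_eq_succ_of_ne_zero (n := n) (by rintro rfl; simp [h0] at hn)
    have := hr k
    rw [show y (k + 1) = some 0 from hn] at this
    rcases rate_some_ne_zero this with ⟨h1, -⟩ | ⟨j, -, hj⟩
    · refine ⟨k, rfl, h1, fun j hj => ?_⟩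
      obtain rfl : j = 0 := by omega
      exact hn
    · omega
  | succ i ih =>
    obtain ⟨k, rfl⟩ := Nat.exists_eq_succ_of_ne_zero (n := n) (by rintro rfl; simp [h0] at hn)
    have := hr k
    rw [show y (k + 1) = some (i + 1) from hn] at this
    rcases rate_some_ne_zero this with ⟨-, h1⟩ | ⟨j, h1, hj⟩
    · omega
    · obtain rfl : i = j := by omega
      obtain ⟨m, rfl, hm, hc⟩ := ih h1
      refine ⟨m, by omega, hm, fun j hj => ?_⟩
      rcases Nat.lt_or_ge i j with hij | hij
      · obtain rfl : j = i + 1 := by omega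
        exact hn
      · exact hc j hij

end Path
-- Solution of the renewal equation
/-- The bounded solution of the renewal equation of a two-state chain converges. -/
lemma tendsto_of_renewal {lam β : ℝ} (hlam : 0 < lam) (hβ : 0 < β) {p : ℝ → ℝ}
    (hm : Measurable p) (hp0 : ∀ u, 0 ≤ p u) (hp1 : ∀ u, p u ≤ 1)
    (hren : ∀ t, 0 ≤ t → p t = Real.exp (-(lam * t)) +
      β * ∫ u in 0..t, Real.exp (-(lam * (t - u))) * (1 - p u)) :
    Tendsto p atTop (𝓝 (β / (lam + β))) := by
  have hint : ∀ a b, IntervalIntegrable (fun u => Real.exp (lam * u) * (1 - p u)) volume a b := by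
    intro a b
    refine IntervalIntegrable.continuousOn_mul ?_ (by fun_prop)
    rw [intervalIntegrable_iff]
    refine Measure.integrableOn_of_bounded (M := 1) measure_Ioc_lt_top.ne (by fun_prop) ?_
    refine Eventually.of_forall fun u => ?_
    rw [Real.norm_eq_abs, abs_le]
    constructor <;> linarith [hp0 u, hp1 u]
  have hp : ∀ t, 0 ≤ t → p t = Real.exp (-(lam * t)) *
      (1 + β * ∫ u in 0..t, Real.exp (lam * u) * (1 - p u)) := by
    intro t ht
    rw [hren t ht, mul_add, mul_one, mul_left_comm,
      ← intervalIntegral.integral_const_mul (Real.exp (-(lam * t)))]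
    congr 2
    refine intervalIntegral.integral_congr fun u _ => ?_
    rw [← mul_assoc, ← Real.exp_add]
    congr 2
    ring
  -- `p` is only measurable; `k` is a continuous function equal to it on `[0, ∞)`, which makes the
  -- integral differentiable.
  set k : ℝ → ℝ := fun t => Real.exp (-(lam * t)) *
      (1 + β * ∫ u in 0..t, Real.exp (lam * u) * (1 - p u)) with hk
  have hpk : ∀ t, 0 ≤ t → p t = k t := hp
  have hkc : Continuous k := by
    have := intervalIntegral.continuous_primitive hint 0
    fun_prop
  set I : ℝ → ℝ := fun t => ∫ u in 0..t, Real.exp (lam * u) * (1 - k u) with hI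
  have hId : ∀ t, HasDerivAt I (Real.exp (lam * t) * (1 - k t)) t := fun t =>
    (Continuous.integral_hasStrictDerivAt (by fun_prop) 0 t).hasDerivAt
  have hkI : ∀ t, 0 ≤ t → k t = Real.exp (-(lam * t)) * (1 + β * I t) := by
    intro t ht
    simp only [hk, hI]
    congr 3
    refine intervalIntegral.integral_congr fun u hu => ?_
    rw [uIcc_of_le ht] at hu
    rw [hpk u hu.1]
  -- The function `w = 1 + β * I` solves w' + βw = β exp(λt) on `[0, ∞)`. Multiplying by the
  -- integrating factor exp(βt) and integrating yields this conserved quantity.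
  set φ : ℝ → ℝ := fun t => Real.exp (β * t) * (1 + β * I t) -
    β / (lam + β) * Real.exp ((lam + β) * t) with hφ
  have hexp : ∀ c t : ℝ, HasDerivAt (fun t => Real.exp (c * t)) (Real.exp (c * t) * c) t := by
    intro c t
    simpa using ((hasDerivAt_id t).const_mul c).exp
  have hφd : ∀ t, 0 ≤ t → HasDerivAt φ 0 t := by
    intro t ht
    have h1 := ((hexp β t).mul (((hId t).const_mul β).const_add 1)).sub
      ((hexp (lam + β) t).const_mul (β / (lam + β)))
    refine h1.congr_deriv ?_
    have h2 : 1 + β * I t = Real.exp (lam * t) * k t := by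
      rw [hkI t ht, ← mul_assoc, ← Real.exp_add, add_neg_cancel, Real.exp_zero, one_mul]
    rw [h2, add_mul, Real.exp_add]
    field_simp
    ring
  have hconst : ∀ t, 0 ≤ t → φ t = φ 0 := by
    intro t ht
    refine constant_of_has_deriv_right_zero (a := 0) (b := t) (fun x hx =>
      (hφd x hx.1).continuousAt.continuousWithinAt) (fun x hx => (hφd x hx.1).hasDerivWithinAt)
      t ⟨ht, le_rfl⟩
  have hsol : ∀ t, 0 ≤ t → p t = β / (lam + β) + φ 0 * Real.exp (-((lam + β) * t)) := by
    intro t ht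
    rw [hpk t ht, hkI t ht, ← hconst t ht]
    simp only [hφ]
    have e1 : Real.exp (β * t) * Real.exp (-((lam + β) * t)) = Real.exp (-(lam * t)) := by
      rw [← Real.exp_add]; congr 1; ring
    have e2 : Real.exp ((lam + β) * t) * Real.exp (-((lam + β) * t)) = 1 := by
      rw [← Real.exp_add, add_neg_cancel, Real.exp_zero]
    rw [← e1]
    linear_combination (β / (lam + β)) * e2
  have hlim : Tendsto (fun t => β / (lam + β) + φ 0 * Real.exp (-((lam + β) * t))) atTop
      (𝓝 (β / (lam + β) + φ 0 * 0)) := by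
    refine tendsto_const_nhds.add (Tendsto.const_mul _ ?_)
    exact Real.tendsto_exp_neg_atTop_nhds_zero.comp
      (tendsto_id.const_mul_atTop (add_pos hlam hβ))
  rw [mul_zero, add_zero] at hlim
  refine hlim.congr' ?_
  filter_upwards [eventually_ge_atTop 0] with t ht
  exact (hsol t ht).symm

/-! ### Decomposition according to the number of jumps -/

section Windows

variable {S Ω : Type*} [MeasurableSpace Ω] {P : Measure Ω} {r : S → S → ℝ} {x₀ : S}
  {Y : ℕ → Ω → S} {H : ℕ → Ω → ℝ}

lemma strictMono_jumpTime {Ω : Type*} {H : ℕ → Ω → ℝ} {ω : Ω} (hω : ∀ k, 0 < H k ω) :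
    StrictMono fun n => jumpTime H n ω :=
  strictMono_nat_of_lt_succ fun n => by rw [jumpTime_succ]; linarith [hω n]

lemma window_index_unique {Ω : Type*} {H : ℕ → Ω → ℝ} {ω : Ω} (hω : ∀ k, 0 < H k ω) {m n : ℕ}
    {t : ℝ} (hm : ω ∈ window H m t) (hn : ω ∈ window H n t) : m = n := by
  have hmono := strictMono_jumpTime hω
  have h1 := hmono.lt_iff_lt.1 (hm.1.trans_lt hn.2)
  have h2 := hmono.lt_iff_lt.1 (hn.1.trans_lt hm.2)
  omega

lemma jumpTime_nonneg {Ω : Type*} {H : ℕ → Ω → ℝ} {ω : Ω} (hω : ∀ k, 0 < H k ω) (n : ℕ) :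
    0 ≤ jumpTime H n ω := Finset.sum_nonneg fun k _ => (hω k).le

/-- The probability of being at `x` at time `t`, decomposed along the number of jumps. -/
noncomputable def occupation (P : Measure Ω) (Y : ℕ → Ω → S) (H : ℕ → Ω → ℝ) (x : S) (t : ℝ) :
    ENNReal :=
  ∑' n, P ({ω | Y n ω = x} ∩ window H n t)

namespace IsJumpHold

/-- Windows of different indices are almost surely disjoint because jump times strictly increase.
The injection `k` allows pieces indexed by where a climb starts rather than by where it ends. -/
lemma lintegral_eq_tsum_window (h : IsJumpHold P r x₀ Y H) (hpos : ∀ᵐ ω ∂P, ∀ k, 0 < H k ω)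
    {B : ℕ → Set Ω} (hB : ∀ n, MeasurableSet (B n)) {k : ℕ → ℕ} (hk : Function.Injective k) {t : ℝ}
    {C : Set Ω} (hC : ∀ᵐ ω ∂P, ω ∈ C ↔ ∃ n, ω ∈ B n ∩ window H (k n) t) (f : Ω → ENNReal) :
    ∫⁻ ω in C, f ω ∂P = ∑' n, ∫⁻ ω in B n ∩ window H (k n) t, f ω ∂P := by
  rw [← lintegral_iUnion₀]
  · refine setLIntegral_congr ?_
    filter_upwards [hC] with ω hω
    exact propext (hω.trans mem_iUnion.symm)
  · exact fun n => ((hB n).inter (h.measurableSet_window _ t)).nullMeasurableSet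
  · intro m n hmn
    refine measure_mono_null ?_ (ae_iff.1 hpos)
    rintro ω ⟨h1, h2⟩ hω
    exact hmn (hk (window_index_unique hω h1.2 h2.2))

lemma measure_eq_tsum_window (h : IsJumpHold P r x₀ Y H) (hpos : ∀ᵐ ω ∂P, ∀ k, 0 < H k ω)
    {B : ℕ → Set Ω} (hB : ∀ n, MeasurableSet (B n)) {t : ℝ}
    {C : Set Ω} (hC : ∀ᵐ ω ∂P, ω ∈ C ↔ ∃ n, ω ∈ B n ∩ window H n t) :
    P C = ∑' n, P (B n ∩ window H n t) := by
  simpa using h.lintegral_eq_tsum_window hpos hB Function.injective_id hC 1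

/-- As `t` varies, these are the sections of one measurable set of the product of time and `Ω`. -/
lemma measurable_measure_inter_window [IsProbabilityMeasure P] (h : IsJumpHold P r x₀ Y H)
    {A : Set Ω} (hA : MeasurableSet A) (n : ℕ) : Measurable fun t => P (A ∩ window H n t) := by
  have h1 := h.measurable_jumpTime n
  have h2 := h.measurable_jumpTime (n + 1)
  have hs : MeasurableSet ((univ : Set ℝ) ×ˢ A ∩
      ({w : ℝ × Ω | jumpTime H n w.2 ≤ w.1} ∩ {w | w.1 < jumpTime H (n + 1) w.2})) :=
    (MeasurableSet.univ.prod hA).inter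
      ((measurableSet_le (by fun_prop) (by fun_prop)).inter
        (measurableSet_lt (by fun_prop) (by fun_prop)))
  have h3 := measurable_measure_prodMk_left (ν := P) hs
  convert h3 using 3 with t
  ext ω
  simp [window]

lemma measurable_occupation [IsProbabilityMeasure P] (h : IsJumpHold P r x₀ Y H) (x : S) :
    Measurable (occupation P Y H x) :=
  Measurable.tsum fun n => h.measurable_measure_inter_window (h.meas_Y n x) n

/-- This extends all occupation probabilities by 0 to negative times, so that formulas evaluated at
`t - ∑ j, x j` need no truncation. -/
lemma measure_inter_window_of_neg (hpos : ∀ᵐ ω ∂P, ∀ k, 0 < H k ω) (A : Set Ω) (n : ℕ) {t : ℝ}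
    (ht : t < 0) : P (A ∩ window H n t) = 0 := by
  refine measure_mono_null ?_ (ae_iff.1 hpos)
  rintro ω ⟨-, h1⟩ hω
  linarith [jumpTime_nonneg hω n, h1.1]

lemma measure_state_eq_occupation (h : IsJumpHold P r x₀ Y H) (hpos : ∀ᵐ ω ∂P, ∀ k, 0 < H k ω)
    {s : ℝ≥0 → Ω → S} {t : ℝ≥0}
    (hs : ∀ᵐ ω ∂P, ∃ n, ω ∈ window H n t ∧ s t ω = Y n ω) (x : S) :
    P {ω | s t ω = x} = occupation P Y H x t := by
  refine h.measure_eq_tsum_window hpos (fun n => h.meas_Y n x) ?_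
  filter_upwards [hs, hpos] with ω ⟨n, hn, hsn⟩ hω
  constructor
  · intro hx
    exact ⟨n, hsn.symm.trans hx, hn⟩
  · rintro ⟨m, hm, hmw⟩
    obtain rfl := window_index_unique hω hn hmw
    exact hsn.trans hm

/-- The chain constructed from a jump chain and holding times follows, almost surely, a jump
path. -/
lemma ae_isJumpPath (hpos : ∀ᵐ ω ∂P, ∀ k, 0 < H k ω)
    (hexp : ∀ᵐ ω ∂P, ∀ t : ℝ, ∃ n, t < jumpTime H n ω) {s : ℝ≥0 → Ω → S}
    (hs : ∀ᵐ ω ∂P, ∀ (n : ℕ) (t : ℝ≥0), ∑ k ∈ Finset.range n, H k ω ≤ t →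
      t < ∑ k ∈ Finset.range (n + 1), H k ω → s t ω = Y n ω) :
    ∀ᵐ ω ∂P, IsJumpPath (fun n => Y n ω) (fun n => (jumpTime H n ω).toNNReal)
      (fun t => s t ω) := by
  filter_upwards [hpos, hexp, hs] with ω h1 h2 h3
  have hnn := jumpTime_nonneg h1
  refine ⟨by simp [jumpTime], fun m n hmn => ?_, fun t => ?_, fun n t ha hb => h3 n t ?_ ?_⟩
  · have := strictMono_jumpTime h1 hmn
    exact (Real.toNNReal_lt_toNNReal_iff_of_nonneg (hnn m)).2 this
  · obtain ⟨n, hn⟩ := h2 t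
    exact ⟨n, Real.lt_toNNReal_iff_coe_lt.2 hn⟩
  · exact Real.toNNReal_le_iff_le_coe.1 ha
  · exact Real.lt_toNNReal_iff_coe_lt.1 hb

end IsJumpHold

lemma IsJumpPath.exists_window {Ω S : Type*} {Y : ℕ → Ω → S} {H : ℕ → Ω → ℝ} {s : ℝ≥0 → Ω → S}
    {ω : Ω} (h : IsJumpPath (fun n => Y n ω) (fun n => (jumpTime H n ω).toNNReal)
      (fun t => s t ω)) (t : ℝ≥0) : ∃ n, ω ∈ window H n t ∧ s t ω = Y n ω := by
  obtain ⟨n, h1, h2⟩ := h.exists_index t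
  exact ⟨n, ⟨Real.toNNReal_le_iff_le_coe.1 h1, Real.lt_toNNReal_iff_coe_lt.1 h2⟩, h.eq n t h1 h2⟩

end Windows

/-! ### Exit rates of the 1G1B system -/

section Rates

variable {lam mu q p : ℝ}

lemma exitRate_none : exitRate (rate lam mu q p) none = lam := by
  rw [exitRate, tsum_eq_single (some 0)]
  · simp [rate]
  · rintro (_ | j) hj
    · rfl
    · have : j ≠ 0 := by rintro rfl; exact hj rfl
      simp [rate, this]

lemma exitRate_some (i : ℕ) : exitRate (rate lam mu q p) (some i) = mu + lam * q := by
  rw [exitRate, tsum_eq_sum (s := {none, some (i + 1)})]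
  · rw [Finset.sum_pair (by simp)]
    simp only [rate, if_true]
    ring
  · rintro (_ | j) hj
    · simp at hj
    · have : j ≠ i + 1 := by rintro rfl; simp at hj
      simp [rate, this]

lemma rate_nonneg (hlam : 0 < lam) (hmu : 0 ≤ mu) (hq : q ∈ Set.Icc (0 : ℝ) 1)
    (hp : p ∈ Set.Icc (0 : ℝ) 1) (x y : Option ℕ) : 0 ≤ rate lam mu q p x y := by
  have h1 : 0 ≤ lam * q := mul_nonneg hlam.le hq.1
  have h2 : 0 ≤ lam * q * p := mul_nonneg h1 hp.1
  have h3 : 0 ≤ lam * q * (1 - p) := mul_nonneg h1 (by linarith [hp.2])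
  rcases x with _ | i <;> rcases y with _ | j <;> simp only [rate]
  · exact le_rfl
  · split_ifs <;> linarith
  · linarith
  · split_ifs <;> linarith

end Rates

/-! ### Law of a climb, and the renewal equation at `none` -/

section Climb

variable {Ω : Type*}

/-- The event that the `m`-th state is `none` and the next `i + 1` jumps lead to levels
`0, …, i`. -/
def climb (Y : ℕ → Ω → Option ℕ) (m : ℕ) : ℕ → Set Ω
  | 0 => {ω | Y m ω = none} ∩ {ω | Y (m + 1) ω = some 0}
  | i + 1 => climb Y m i ∩ {ω | Y (m + 1 + i + 1) ω = some (i + 1)}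

lemma mem_climb {Y : ℕ → Ω → Option ℕ} {m i : ℕ} {ω : Ω} :
    ω ∈ climb Y m i ↔ Y m ω = none ∧ ∀ j ≤ i, Y (m + 1 + j) ω = some j := by
  induction i with
  | zero => simp [climb]
  | succ i ih =>
    simp only [climb, mem_inter_iff, ih, mem_ofPred_eq, Nat.le_succ_iff, or_imp, forall_and,
      forall_eq, and_assoc]
    rfl

lemma climb_subset (Y : ℕ → Ω → Option ℕ) (m i : ℕ) :
    climb Y m i ⊆ {ω | Y (m + 1 + i) ω = some i} :=
  fun _ hω => (mem_climb.1 hω).2 i le_rfl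

lemma measurableSet_history_climb (Y : ℕ → Ω → Option ℕ) (H : ℕ → Ω → ℝ) (m i : ℕ) :
    MeasurableSet[history Y H (m + 1 + i)] (climb Y m i) := by
  induction i with
  | zero =>
    exact (measurableSet_history_jump (by omega) _).inter (measurableSet_history_jump le_rfl _)
  | succ i ih =>
    exact (history_mono Y H (by omega) _ ih).inter (measurableSet_history_jump le_rfl _)

/-- The holding times in the levels below the current one. -/
def completedTimes (H : ℕ → Ω → ℝ) (m i : ℕ) (ω : Ω) : Fin i → ℝ := fun j => H (m + 1 + j) ω

lemma snoc_completedTimes (H : ℕ → Ω → ℝ) (m i : ℕ) (ω : Ω) :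
    (Fin.snoc (completedTimes H m i ω) (H (m + 1 + i) ω) : Fin (i + 1) → ℝ) =
      completedTimes H m (i + 1) ω := by
  funext j
  induction j using Fin.lastCases with
  | last => simp [completedTimes]
  | cast j => simp [completedTimes]

lemma measurable_history_completedTimes (Y : ℕ → Ω → Option ℕ) (H : ℕ → Ω → ℝ) (m i : ℕ) :
    Measurable[history Y H (m + 1 + i)] (completedTimes H m i) := by
  let _ := history Y H (m + 1 + i)
  exact measurable_pi_iff.2 fun j => measurable_history_hold (by omega)

lemma measurable_snoc (n : ℕ) :
    Measurable fun w : (Fin n → ℝ) × ℝ => (Fin.snoc w.1 w.2 : Fin (n + 1) → ℝ) := by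
  refine measurable_pi_iff.2 fun j => ?_
  induction j using Fin.lastCases with
  | last => simpa using measurable_snd
  | cast j => simpa [Function.comp_def] using (measurable_pi_apply j).comp measurable_fst

lemma isProbabilityMeasure_iidExp {a : ℝ} (ha : 0 < a) (i : ℕ) :
    IsProbabilityMeasure (iidExp a i) := by
  have := isProbabilityMeasure_expMeasure ha
  unfold iidExp
  infer_instance

lemma lintegral_iidExp_zero {a : ℝ} (ha : 0 < a) {g : (Fin 1 → ℝ) → ENNReal} (hg : Measurable g) :
    ∫⁻ x, g x ∂(iidExp a 0) = ∫⁻ v, g (fun _ => v) ∂(expMeasure a) := by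
  have := isProbabilityMeasure_expMeasure ha
  have h1 := (measurePreserving_funUnique (expMeasure a) (Fin 1)).symm
  exact (h1.lintegral_comp hg).symm

lemma lintegral_iidExp_succ {a : ℝ} (ha : 0 < a) (i : ℕ) {g : (Fin (i + 2) → ℝ) → ENNReal}
    (hg : Measurable g) :
    ∫⁻ x, g x ∂(iidExp a (i + 1)) =
      ∫⁻ v, ∫⁻ x, g (Fin.snoc x v) ∂(iidExp a i) ∂(expMeasure a) := by
  have := isProbabilityMeasure_expMeasure ha
  have := isProbabilityMeasure_iidExp ha i
  have h1 := (measurePreserving_piFinSuccAbove (fun _ : Fin (i + 2) => expMeasure a)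
    (Fin.last (i + 1))).symm
  rw [show iidExp a (i + 1) = Measure.pi fun _ : Fin (i + 2) => expMeasure a from rfl,
    ← h1.lintegral_comp hg, lintegral_prod _ (by fun_prop)]
  refine lintegral_congr fun v => ?_
  rw [iidExp]
  refine lintegral_congr fun x => ?_
  congr 1
  exact Fin.insertNth_last' v x

variable [MeasurableSpace Ω] {P : Measure Ω} {lam mu q p : ℝ} {Y : ℕ → Ω → Option ℕ}
  {H : ℕ → Ω → ℝ}

namespace IsJumpHold

/-- Levels are peeled off from the top. The age of the current visit is exponential, and what
remains is a shorter climb seen at an earlier time, whose last holding time now plays the part of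
the age. The jump from `none` contributes λ/(μ + λq), and each later one λqp/(μ + λq). -/
lemma lintegral_climb [IsProbabilityMeasure P] (h : IsJumpHold P (rate lam mu q p) none Y H)
    (he : ∀ x, 0 < exitRate (rate lam mu q p) x) (hr : ∀ x y, 0 ≤ rate lam mu q p x y)
    (m i : ℕ) (t : ℝ) {g : (Fin (i + 1) → ℝ) → ENNReal} (hg : Measurable g) :
    ∫⁻ ω in climb Y m i ∩ window H (m + 1 + i) t,
        g (Fin.snoc (completedTimes H m i ω) (t - jumpTime H (m + 1 + i) ω)) ∂P =
      ENNReal.ofReal (lam / (mu + lam * q)) * ENNReal.ofReal (lam * q * p / (mu + lam * q)) ^ i *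
        ∫⁻ x, g x * P ({ω | Y m ω = none} ∩ window H m (t - ∑ j, x j))
          ∂(iidExp (mu + lam * q) i) := by
  have ha : 0 < mu + lam * q := exitRate_some (lam := lam) (mu := mu) (q := q) (p := p) 0 ▸ he _
  obtain ⟨W, hWm, hW⟩ : ∃ W : ℝ → ENNReal, Measurable W ∧
      ∀ τ, P ({ω | Y m ω = none} ∩ window H m τ) = W τ :=
    ⟨_, h.measurable_measure_inter_window (h.meas_Y m none) m, fun _ => rfl⟩
  simp only [hW]
  induction i generalizing t with
  | zero =>
    have h1 := h.lintegral_last_jump he hr (some 0) (A := {ω | Y m ω = none})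
      (measurableSet_history_jump le_rfl _) subset_rfl (Z := fun _ => ()) measurable_const
      (G := fun w => g (fun _ => w.2.2)) (by fun_prop) t
    rw [exitRate_some] at h1
    simp only [lintegral_const, Measure.restrict_apply_univ, hW] at h1
    rw [lintegral_iidExp_zero ha (by fun_prop), pow_zero, mul_one]
    simp only [Fin.sum_univ_succ, Fin.sum_univ_zero, add_zero]
    refine Eq.trans (lintegral_congr fun ω => ?_) h1
    congr 1
  | succ i ih =>
    have hsn := measurable_snoc i
    have hsn' := measurable_snoc (i + 1)
    have h1 := h.lintegral_last_jump he hr (some (i + 1)) (measurableSet_history_climb Y H m i)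
      (climb_subset Y m i) (measurable_history_completedTimes Y H m i)
      (G := fun w => g (Fin.snoc (Fin.snoc w.1 w.2.1 : Fin (i + 1) → ℝ) w.2.2))
      (hg.comp (hsn'.comp ((hsn.comp (measurable_fst.prodMk measurable_snd.fst)).prodMk
        measurable_snd.snd))) t
    rw [exitRate_some] at h1
    simp only [snoc_completedTimes] at h1
    -- The induction hypothesis is used at time `t - v`, with the last coordinate of `g` frozen at
    -- `v`.
    have h2 : ∀ v, ∫⁻ ω in climb Y m i ∩ window H (m + 1 + i) (t - v),
        g (Fin.snoc (Fin.snoc (completedTimes H m i ω) (t - v - jumpTime H (m + 1 + i) ω) :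
          Fin (i + 1) → ℝ) v) ∂P = _ := fun v =>
      ih (t - v) (g := fun x => g (Fin.snoc x v))
        (hg.comp (hsn'.comp (measurable_id.prodMk measurable_const)))
    rw [lintegral_congr h2] at h1
    rw [lintegral_iidExp_succ ha i (by fun_prop), pow_succ]
    refine h1.trans ?_
    rw [lintegral_const_mul]
    · rw [show rate lam mu q p (some i) (some (i + 1)) = lam * q * p by simp [rate]]
      simp only [Fin.sum_snoc]
      rw [← mul_assoc]
      congr 1
      · ring
      · refine lintegral_congr fun v => lintegral_congr fun x => ?_
        rw [sub_add_eq_sub_sub_swap]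
    · have := isProbabilityMeasure_iidExp ha i
      refine Measurable.lintegral_prod_right' (f := fun w : ℝ × (Fin (i + 1) → ℝ) =>
        g (Fin.snoc w.2 w.1) * W (t - w.1 - ∑ j, w.2 j))
        (Measurable.mul ?_ ?_)
      · exact hg.comp (hsn'.comp measurable_swap)
      · fun_prop

/-- The renewal equation, in terms of the time since the last loss of the link. -/
lemma occupation_none_eq [IsProbabilityMeasure P] (h : IsJumpHold P (rate lam mu q p) none Y H)
    (he : ∀ x, 0 < exitRate (rate lam mu q p) x) (hr : ∀ x y, 0 ≤ rate lam mu q p x y) (t : ℝ) :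
    occupation P Y H none t = survival lam t + ENNReal.ofReal ((mu + lam * q * (1 - p)) / lam) *
      ∫⁻ v, ∑' n, P ({ω | Y n ω = none}ᶜ ∩ window H n (t - v)) ∂(expMeasure lam) := by
  have hlam : 0 < lam := exitRate_none (lam := lam) (mu := mu) (q := q) (p := p) ▸ he none
  have hWc : ∀ n, Measurable fun t => P ({ω | Y n ω = none}ᶜ ∩ window H n t) := fun n =>
    h.measurable_measure_inter_window (h.meas_Y n none).compl n
  -- The term with no jump is the survival of the initial visit to `none`; in the others the last
  -- jump leads into `none`.
  rw [occupation, tsum_eq_zero_add' ENNReal.summable]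
  congr 1
  · have h1 := h.lintegral_window he hr (n := 0) (A := {ω | Y 0 ω = none})
      (measurableSet_history_jump le_rfl _) subset_rfl (Z := fun _ => ()) measurable_const
      (Φ := 1) measurable_const t
    have h2 : P {ω | Y 0 ω = none} = 1 := (prob_compl_eq_zero_iff (h.meas_Y 0 none)).1
      (ae_iff.1 h.ae_start)
    simpa [exitRate_none, jumpTime, h2] using h1
  · rw [lintegral_tsum (f := fun n v => P ({ω | Y n ω = none}ᶜ ∩ window H n (t - v)))
        fun n => ((hWc n).comp (measurable_id.const_sub t)).aemeasurable,
      ← ENNReal.tsum_mul_left]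
    refine tsum_congr fun m => ?_
    rw [measure_eq_tsum_inter_fiber (h.meas_Y m)]
    have h3 : ∀ x, P ({ω | Y (m + 1) ω = none} ∩ window H (m + 1) t ∩ {ω | Y m ω = x}) =
        ENNReal.ofReal ((mu + lam * q * (1 - p)) / lam) * ∫⁻ v,
          P ({ω | Y m ω = none}ᶜ ∩ window H m (t - v) ∩ {ω | Y m ω = x}) ∂(expMeasure lam) := by
      intro x
      have h1 := h.lintegral_last_jump he hr none (A := {ω | Y m ω = x})
        (measurableSet_history_jump le_rfl _) subset_rfl (Z := fun _ => ()) measurable_const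
        (G := 1) measurable_const t
      simp only [Pi.one_apply, lintegral_one, Measure.restrict_apply_univ, exitRate_none] at h1
      rw [inter_right_comm, inter_comm {ω | Y (m + 1) ω = none}, h1]
      -- There is no jump from `none` to itself, and the rate into `none` is the same from all
      -- levels; this is why the equation closes.
      rcases x with _ | i
      · have : ∀ v, {ω | Y m ω = none}ᶜ ∩ window H m (t - v) ∩ {ω | Y m ω = none} = ∅ := by
          intro v
          rw [inter_right_comm, compl_inter_self, empty_inter]
        simp [rate, this]
      · rw [show rate lam mu q p (some i) none = mu + lam * q * (1 - p) from rfl]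
        congr 2
        funext v
        congr 1
        ext ω
        simp only [mem_inter_iff, mem_ofPred_eq, mem_compl_iff]
        constructor
        · rintro ⟨a, b⟩; exact ⟨⟨by simp [a], b⟩, a⟩
        · rintro ⟨⟨a, b⟩, c⟩; exact ⟨c, b⟩
    rw [tsum_congr h3, ENNReal.tsum_mul_left, ← lintegral_tsum]
    · congr 2
      funext v
      rw [← measure_eq_tsum_inter_fiber (h.meas_Y m)]
    · intro x
      have := h.measurable_measure_inter_window ((h.meas_Y m none).compl.inter (h.meas_Y m x)) m
      simp only [inter_right_comm _ (window H m _)]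
      exact (this.comp (measurable_id.const_sub t)).aemeasurable

end IsJumpHold
end Climb
-- Bounds and continuity of the fidelity
section Fidelity

/-- For the upper bound, the fidelities with |φ⁺⟩ and |φ⁻⟩ and the diagonal entries at 01 and 10 are
nonnegative and add up to the trace, which is 1. -/
lemma fidelity_mem_Icc {ρ : TwoQubit} (hρ : IsState ρ) : fidelity ρ ∈ Icc (0 : ℝ) 1 := by
  obtain ⟨hpos, htr⟩ := hρ
  have hs : ((√2 : ℝ) : ℂ)⁻¹ * ((√2 : ℝ) : ℂ)⁻¹ = 1 / 2 := by
    rw [← mul_inv, ← Complex.ofReal_mul, Real.mul_self_sqrt (by norm_num)]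
    norm_num
  refine ⟨(Complex.le_def.1 (hpos.dotProduct_mulVec_nonneg phiPlus)).1, ?_⟩
  have h1 := (Complex.le_def.1 (hpos.dotProduct_mulVec_nonneg
    (fun x : Fin 2 × Fin 2 => if x.1 = x.2 then (if x.1 = 0 then 1 else -1 : ℂ) else 0))).1
  have h2 := (Complex.le_def.1 (hpos.diag_nonneg (i := ((0 : Fin 2), (1 : Fin 2))))).1
  have h3 := (Complex.le_def.1 (hpos.diag_nonneg (i := ((1 : Fin 2), (0 : Fin 2))))).1
  have h4 := congrArg Complex.re htr
  have h5 : star phiPlus ⬝ᵥ ρ *ᵥ phiPlus =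
      (1 / 2) * (ρ (0, 0) (0, 0) + ρ (0, 0) (1, 1) + ρ (1, 1) (0, 0) + ρ (1, 1) (1, 1)) := by
    rw [← hs]
    simp [phiPlus, Matrix.mulVec, dotProduct, Fintype.sum_prod_type, Fin.sum_univ_two]
    ring
  rw [fidelity, h5]
  simp [Matrix.mulVec, dotProduct, Fintype.sum_prod_type, Fin.sum_univ_two, Matrix.trace]
    at h1 h2 h3 h4 ⊢
  linarith

lemma depol_mem_Icc {Γ t F : ℝ} (hΓ : 0 ≤ Γ) (ht : 0 ≤ t) (hF : F ∈ Icc (0 : ℝ) 1) :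
    depol Γ t F ∈ Icc (0 : ℝ) 1 := by
  have h0 := Real.exp_pos (-(Γ * t))
  have h1 : Real.exp (-(Γ * t)) ≤ 1 := Real.exp_le_one_iff.2 (by nlinarith)
  obtain ⟨h2, h3⟩ := hF
  unfold depol
  constructor <;> nlinarith

variable {Γ : ℝ} {J : ℝ → TwoQubit → ℝ} {ρ : TwoQubit}

lemma levelFidelity_mem_Icc (hΓ : 0 ≤ Γ) (hρ : IsState ρ)
    (hJ : ∀ F ∈ Icc (0 : ℝ) 1, J F ρ ∈ Icc (0 : ℝ) 1) (i : ℕ) {x : Fin (i + 1) → ℝ}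
    (hx : ∀ j, 0 ≤ x j) : levelFidelity Γ J ρ i x ∈ Icc (0 : ℝ) 1 := by
  induction i with
  | zero => exact depol_mem_Icc hΓ (hx 0) (fidelity_mem_Icc hρ)
  | succ i ih => exact depol_mem_Icc hΓ (hx _) (hJ _ (ih fun j => hx _))

/-- The jump function, extended to all real fidelities by its values at `0` and `1`. -/
noncomputable def extendJump (J : ℝ → TwoQubit → ℝ) (F : ℝ) (ρ : TwoQubit) : ℝ :=
  J (projIcc (0 : ℝ) 1 zero_le_one F) ρ

/-- For nonnegative times all intermediate fidelities stay in `[0, 1]`, where the projection is the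
identity. So a function continuous on the whole space can replace the original one. -/
lemma levelFidelity_extendJump (hΓ : 0 ≤ Γ) (hρ : IsState ρ)
    (hJ : ∀ F ∈ Icc (0 : ℝ) 1, J F ρ ∈ Icc (0 : ℝ) 1) (i : ℕ) {x : Fin (i + 1) → ℝ}
    (hx : ∀ j, 0 ≤ x j) : levelFidelity Γ (extendJump J) ρ i x = levelFidelity Γ J ρ i x := by
  induction i with
  | zero => rfl
  | succ i ih =>
    rw [levelFidelity, levelFidelity, ih fun j => hx _, extendJump,
      projIcc_of_mem _ (levelFidelity_mem_Icc hΓ hρ hJ i fun j => hx _)]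

lemma continuous_levelFidelity_extendJump (hJ : ContinuousOn (fun F => J F ρ) (Icc 0 1)) (i : ℕ) :
    Continuous (levelFidelity Γ (extendJump J) ρ i) := by
  have hJ' : Continuous fun F => extendJump J F ρ :=
    hJ.comp_continuous (continuous_subtype_val.comp continuous_projIcc) fun F => Subtype.coe_prop _
  induction i with
  | zero =>
    change Continuous fun x : Fin (0 + 1) → ℝ => depol Γ (x 0) (fidelity ρ)
    unfold depol
    fun_prop
  | succ i ih =>
    have : Continuous fun x : Fin (i + 1 + 1) → ℝ =>
        levelFidelity Γ (extendJump J) ρ i (fun j => x j.castSucc) := ih.comp (by fun_prop)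
    change Continuous fun x : Fin (i + 1 + 1) → ℝ => depol Γ (x (Fin.last (i + 1)))
      (extendJump J (levelFidelity Γ (extendJump J) ρ i fun j => x j.castSucc) ρ)
    unfold depol
    fun_prop

end Fidelity

/-! ### Exact law of the level times, and its limit -/

section Chain

variable {Ω : Type*} [MeasurableSpace Ω]

/-- The almost sure properties of the jump chain and the holding times of a 1G1B system. -/
structure IsLinkChain (P : Measure Ω) (lam mu q p : ℝ) (s : ℝ≥0 → Ω → Option ℕ)
    (Y : ℕ → Ω → Option ℕ) (H : ℕ → Ω → ℝ) : Prop where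
  jump : IsJumpHold P (rate lam mu q p) none Y H
  meas : ∀ t x, MeasurableSet {ω | s t ω = x}
  exit_pos : ∀ x, 0 < exitRate (rate lam mu q p) x
  rate_nn : ∀ x y, 0 ≤ rate lam mu q p x y
  hold_pos : ∀ᵐ ω ∂P, ∀ k, 0 < H k ω
  start : ∀ᵐ ω ∂P, Y 0 ω = none
  trans : ∀ᵐ ω ∂P, ∀ n, rate lam mu q p (Y n ω) (Y (n + 1) ω) ≠ 0
  path : ∀ᵐ ω ∂P, IsJumpPath (fun n => Y n ω) (fun n => (jumpTime H n ω).toNNReal)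
    (fun t => s t ω)

lemma Is1G1B.exists_isLinkChain {P : Measure Ω} [IsProbabilityMeasure P] {lam mu q p : ℝ}
    (hlam : 0 < lam) (hmu : 0 ≤ mu) (hq : q ∈ Icc (0 : ℝ) 1) (hp : p ∈ Icc (0 : ℝ) 1)
    (ha : 0 < mu + lam * q) {s : ℝ≥0 → Ω → Option ℕ} (hs : Is1G1B P lam mu q p s) :
    ∃ Y H, IsLinkChain P lam mu q p s Y H := by
  obtain ⟨hsm, Y, H, hY, hH, hlaw, hsY⟩ := hs
  have h : IsJumpHold P (rate lam mu q p) none Y H := ⟨hY, hH, hlaw⟩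
  have he : ∀ x, 0 < exitRate (rate lam mu q p) x := by
    rintro (_ | i)
    · rwa [exitRate_none]
    · rwa [exitRate_some]
  have hM : ∀ x, exitRate (rate lam mu q p) x ≤ max lam (mu + lam * q) := by
    rintro (_ | i)
    · rw [exitRate_none]; exact le_max_left _ _
    · rw [exitRate_some]; exact le_max_right _ _
  have hr := rate_nonneg hlam hmu hq hp
  have hpos := h.ae_hold_pos he
  exact ⟨Y, H, h, hsm, he, hr, hpos, h.ae_start, h.ae_rate_ne_zero he hr,
    IsJumpHold.ae_isJumpPath hpos (h.ae_exists_lt_jumpTime he hr hM) hsY⟩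

/-- The steady-state probability of level `i`, relative to that of `none`. -/
noncomputable def levelWeight (lam mu q p : ℝ) (i : ℕ) : ℝ :=
  lam / (mu + lam * q) * (lam * q * p / (mu + lam * q)) ^ i

lemma levelWeight_nonneg {lam mu q p : ℝ} (hlam : 0 < lam) (hq : q ∈ Icc (0 : ℝ) 1)
    (hp : p ∈ Icc (0 : ℝ) 1) (ha : 0 < mu + lam * q) (i : ℕ) : 0 ≤ levelWeight lam mu q p i :=
  mul_nonneg (div_nonneg hlam.le ha.le)
    (pow_nonneg (div_nonneg (mul_nonneg (mul_nonneg hlam.le hq.1) hp.1) ha.le) _)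

/-- The geometric ratio is below 1 because μ + λq exceeds λqp by exactly the loss rate μ + λq(1 -
p). -/
lemma summable_levelWeight {lam mu q p : ℝ} (hlam : 0 < lam) (hq : q ∈ Icc (0 : ℝ) 1)
    (hp : p ∈ Icc (0 : ℝ) 1) (ha : 0 < mu + lam * q) (hloss : 0 < mu + lam * q * (1 - p)) :
    Summable (levelWeight lam mu q p) := by
  refine (summable_geometric_of_lt_one
    (div_nonneg (mul_nonneg (mul_nonneg hlam.le hq.1) hp.1) ha.le) ?_).mul_left _
  rw [div_lt_one ha]
  linarith

/-- This holds for every path, however irregular: `visitEnd` itself belongs to the set whose infimum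
is `visitStart`, the condition there being vacuous. -/
lemma levelTimes_nonneg (f : ℝ≥0 → Option ℕ) (t : ℝ≥0) (i : ℕ) (j : Fin (i + 1)) :
    0 ≤ levelTimes f t i j := by
  rw [levelTimes, sub_nonneg, NNReal.coe_le_coe]
  exact csInf_le (OrderBot.bddBelow _) ⟨le_rfl, fun v h1 h2 => absurd h1 (not_le.2 h2)⟩

lemma ae_iidExp_nonneg {a : ℝ} (ha : 0 < a) (i : ℕ) : ∀ᵐ x ∂(iidExp a i), ∀ j, 0 ≤ x j := by
  have := isProbabilityMeasure_expMeasure ha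
  have h0 : ∀ᵐ v ∂(expMeasure a), 0 ≤ v := by
    have h1 : expMeasure a (Ioi 0) = 1 := by rw [expMeasure_Ioi ha]; simp
    filter_upwards [(mem_ae_iff_prob_eq_one measurableSet_Ioi).2 h1] with v hv
    exact le_of_lt hv
  exact ae_all_iff.2 fun j => Measure.tendsto_eval_ae_ae.eventually h0

namespace IsLinkChain

variable {P : Measure Ω} {lam mu q p : ℝ} {s : ℝ≥0 → Ω → Option ℕ}
  {Y : ℕ → Ω → Option ℕ} {H : ℕ → Ω → ℝ}

/-- Since only transitions of positive rate occur and the chain starts at `none`, each presence at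
level `i` ends a climb begun at some jump `m`. -/
lemma ae_mem_level_iff (h : IsLinkChain P lam mu q p s Y H) (t : ℝ≥0) (i : ℕ) :
    ∀ᵐ ω ∂P, ω ∈ {ω | s t ω = some i} ↔ ∃ m, ω ∈ climb Y m i ∩ window H (m + 1 + i) t := by
  filter_upwards [h.hold_pos, h.start, h.trans, h.path] with ω hω h0 htr hpath
  obtain ⟨n, hn, hsn⟩ := hpath.exists_window t
  constructor
  · intro hi
    obtain ⟨m, rfl, hm⟩ := exists_climb h0 htr (i := i) (n := n) (hsn.symm.trans hi)
    exact ⟨m, mem_climb.2 hm, hn⟩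
  · rintro ⟨m, hm, hw⟩
    obtain rfl := window_index_unique hω hn hw
    exact hsn.trans (climb_subset Y m i hm)

lemma ae_levelTimes_eq (h : IsLinkChain P lam mu q p s Y H) (t : ℝ≥0) (m i : ℕ) :
    ∀ᵐ ω ∂P, ω ∈ climb Y m i ∩ window H (m + 1 + i) t → levelTimes (fun u => s u ω) t i =
      Fin.snoc (completedTimes H m i ω) (t - jumpTime H (m + 1 + i) ω) := by
  filter_upwards [h.hold_pos, h.path] with ω hω hpath ⟨hc, hw⟩
  obtain ⟨h0, hy⟩ := mem_climb.1 hc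
  rw [hpath.levelTimes_eq h0 hy (Real.toNNReal_le_iff_le_coe.2 hw.1)
    (Real.lt_toNNReal_iff_coe_lt.2 hw.2)]
  simp only [Real.coe_toNNReal _ (jumpTime_nonneg hω _)]
  simp only [jumpTime_succ, add_sub_cancel_left]
  rfl

lemma measurableSet_climb (h : IsLinkChain P lam mu q p s Y H) (m i : ℕ) :
    MeasurableSet (climb Y m i) :=
  h.jump.history_le _ _ (measurableSet_history_climb Y H m i)

lemma measurable_snoc_completedTimes (h : IsLinkChain P lam mu q p s Y H) (t : ℝ) (m i : ℕ) :
    Measurable fun ω => (Fin.snoc (completedTimes H m i ω) (t - jumpTime H (m + 1 + i) ω) :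
      Fin (i + 1) → ℝ) :=
  (measurable_snoc i).comp (((measurable_history_completedTimes Y H m i).mono
    (h.jump.history_le _) le_rfl).prodMk ((h.jump.measurable_jumpTime _).const_sub t))

lemma ae_restrict_levelTimes_eq (h : IsLinkChain P lam mu q p s Y H) (t : ℝ≥0) (m i : ℕ) :
    (fun ω => levelTimes (fun u => s u ω) t i) =ᵐ[P.restrict (climb Y m i ∩ window H (m + 1 + i) t)]
      fun ω => Fin.snoc (completedTimes H m i ω) (t - jumpTime H (m + 1 + i) ω) := by
  rw [Filter.EventuallyEq, ae_restrict_iff'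
    ((h.measurableSet_climb m i).inter (h.jump.measurableSet_window _ _))]
  exact h.ae_levelTimes_eq t m i

/-- Level times are defined by suprema and infima over uncountable sets; measurability comes from
the explicit formula on each of countably many climbs. -/
lemma aemeasurable_levelTimes (h : IsLinkChain P lam mu q p s Y H) (t : ℝ≥0) (i : ℕ) :
    AEMeasurable (fun ω => levelTimes (fun u => s u ω) t i)
      (P.restrict {ω | s t ω = some i}) := by
  have : ({ω | s t ω = some i} : Set Ω) =ᵐ[P] ⋃ m, climb Y m i ∩ window H (m + 1 + i) t := by
    filter_upwards [h.ae_mem_level_iff t i] with ω hω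
    exact propext (hω.trans mem_iUnion.symm)
  rw [Measure.restrict_congr_set this, aemeasurable_iUnion_iff]
  exact fun m => ⟨_, h.measurable_snoc_completedTimes t m i, h.ae_restrict_levelTimes_eq t m i⟩

lemma measureReal_none (h : IsLinkChain P lam mu q p s Y H) (t : ℝ≥0) :
    P.real {ω | s t ω = none} = (occupation P Y H none t).toReal := by
  rw [measureReal_def, h.jump.measure_state_eq_occupation h.hold_pos
    (h.path.mono fun ω hω => hω.exists_window t)]

variable [IsProbabilityMeasure P]

/-- Summing the law of a climb over its starting index `m` reassembles the probability of being at
`none` at the time the climb began. -/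
lemma lintegral_levelTimes (h : IsLinkChain P lam mu q p s Y H) (hlam : 0 < lam)
    (ha : 0 < mu + lam * q) (hqp : 0 ≤ lam * q * p) (t : ℝ≥0) (i : ℕ)
    {g : (Fin (i + 1) → ℝ) → ENNReal} (hg : Measurable g) :
    ∫⁻ ω in {ω | s t ω = some i}, g (levelTimes (fun u => s u ω) t i) ∂P =
      ENNReal.ofReal (levelWeight lam mu q p i) *
        ∫⁻ x, g x * occupation P Y H none (t - ∑ j, x j) ∂(iidExp (mu + lam * q) i) := by
  rw [h.jump.lintegral_eq_tsum_window h.hold_pos (fun m => h.measurableSet_climb m i)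
    (k := fun m => m + 1 + i) (fun m n hmn => by simpa using hmn) (h.ae_mem_level_iff t i)]
  have h1 : ∀ m, ∫⁻ ω in climb Y m i ∩ window H (m + 1 + i) t,
      g (levelTimes (fun u => s u ω) t i) ∂P = ENNReal.ofReal (levelWeight lam mu q p i) *
        ∫⁻ x, g x * P ({ω | Y m ω = none} ∩ window H m (t - ∑ j, x j))
          ∂(iidExp (mu + lam * q) i) := by
    intro m
    rw [levelWeight, ENNReal.ofReal_mul (div_nonneg hlam.le ha.le),
      ENNReal.ofReal_pow (div_nonneg hqp ha.le),
      ← h.jump.lintegral_climb h.exit_pos h.rate_nn m i t hg]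
    refine lintegral_congr_ae ?_
    filter_upwards [h.ae_restrict_levelTimes_eq t m i] with ω hω
    rw [hω]
  rw [tsum_congr h1, ENNReal.tsum_mul_left, ← lintegral_tsum]
  · simp only [ENNReal.tsum_mul_left]
    rfl
  · intro m
    have hW := h.jump.measurable_measure_inter_window (h.jump.meas_Y m none) m
    refine (hg.mul (hW.comp (g := fun τ => P ({ω | Y m ω = none} ∩ window H m τ))
      (f := fun x : Fin (i + 1) → ℝ => (t : ℝ) - ∑ j, x j) ?_)).aemeasurable
    fun_prop

lemma map_levelTimes (h : IsLinkChain P lam mu q p s Y H) (hlam : 0 < lam)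
    (ha : 0 < mu + lam * q) (hqp : 0 ≤ lam * q * p) (t : ℝ≥0) (i : ℕ) :
    (P.restrict {ω | s t ω = some i}).map (fun ω => levelTimes (fun u => s u ω) t i) =
      (iidExp (mu + lam * q) i).withDensity fun x =>
        ENNReal.ofReal (levelWeight lam mu q p i) * occupation P Y H none (t - ∑ j, x j) := by
  have hocc := h.jump.measurable_occupation none
  ext A hA
  rw [Measure.map_apply_of_aemeasurable (h.aemeasurable_levelTimes t i) hA, withDensity_apply _ hA,
    lintegral_const_mul _ (by fun_prop), ← lintegral_indicator hA]
  have h1 := h.lintegral_levelTimes hlam ha hqp t i (g := A.indicator 1)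
    (measurable_one.indicator hA)
  rw [← lintegral_map' (f := A.indicator 1) (measurable_one.indicator hA).aemeasurable
    (h.aemeasurable_levelTimes t i), lintegral_indicator_one hA,
    Measure.map_apply_of_aemeasurable (h.aemeasurable_levelTimes t i) hA] at h1
  rw [h1]
  congr 2
  funext x
  by_cases hx : x ∈ A <;> simp [hx]

lemma occupation_le_one (h : IsLinkChain P lam mu q p s Y H) (x : Option ℕ) (t : ℝ) :
    occupation P Y H x t ≤ 1 := by
  rcases lt_or_ge t 0 with ht | ht
  · simp [occupation, IsJumpHold.measure_inter_window_of_neg h.hold_pos _ _ ht]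
  · lift t to ℝ≥0 using ht
    rw [← h.jump.measure_state_eq_occupation h.hold_pos (s := s)
      (h.path.mono fun ω hω => hω.exists_window t)]
    exact prob_le_one

lemma tsum_busy (h : IsLinkChain P lam mu q p s Y H) (t : ℝ) :
    ∑' n, P ({ω | Y n ω = none}ᶜ ∩ window H n t) =
      if 0 ≤ t then ENNReal.ofReal (1 - (occupation P Y H none t).toReal) else 0 := by
  split_ifs with ht
  · lift t to ℝ≥0 using ht
    rw [← h.measureReal_none, ← probReal_compl_eq_one_sub (h.meas t none), ofReal_measureReal]
    refine (h.jump.measure_eq_tsum_window h.hold_pos (fun n => (h.jump.meas_Y n none).compl) ?_).symm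
    filter_upwards [h.hold_pos, h.path] with ω hω hpath
    obtain ⟨n, hn, hsn⟩ := hpath.exists_window t
    simp only [mem_compl_iff, mem_ofPred_eq, mem_inter_iff]
    constructor
    · intro hx
      exact ⟨n, hsn ▸ hx, hn⟩
    · rintro ⟨m, hm, hmw⟩
      obtain rfl := window_index_unique hω hn hmw
      exact hsn ▸ hm
  · simp [IsJumpHold.measure_inter_window_of_neg h.hold_pos _ _ (not_le.1 ht)]

lemma renewal (h : IsLinkChain P lam mu q p s Y H) (hlam : 0 < lam)
    (hloss : 0 < mu + lam * q * (1 - p)) {t : ℝ} (ht : 0 ≤ t) :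
    (occupation P Y H none t).toReal = Real.exp (-(lam * t)) + (mu + lam * q * (1 - p)) *
      ∫ u in 0..t, Real.exp (-(lam * (t - u))) * (1 - (occupation P Y H none u).toReal) := by
  have hocc := h.jump.measurable_occupation none
  have hsv := measurable_survival lam
  set k : ℝ → ℝ := fun u => (occupation P Y H none u).toReal with hk
  have hkm : Measurable k := hocc.ennreal_toReal
  have hk0 : ∀ u, 0 ≤ k u := fun u => ENNReal.toReal_nonneg
  have hk1 : ∀ u, k u ≤ 1 := fun u =>
    ENNReal.toReal_le_of_le_ofReal zero_le_one (by simpa using h.occupation_le_one none u)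
  have hnn : ∀ u, 0 ≤ Real.exp (-(lam * (t - u))) * (1 - k u) := fun u =>
    mul_nonneg (Real.exp_pos _).le (by linarith [hk1 u])
  have hbm : Measurable fun u => if 0 ≤ u then ENNReal.ofReal (1 - k u) else 0 :=
    Measurable.ite measurableSet_Ici (by fun_prop) measurable_const
  have hint : IntegrableOn (fun u => Real.exp (-(lam * (t - u))) * (1 - k u)) (Icc 0 t) := by
    refine Measure.integrableOn_of_bounded (M := 1) measure_Icc_lt_top.ne (by fun_prop) ?_
    filter_upwards [ae_restrict_mem measurableSet_Icc] with u hu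
    rw [Real.norm_of_nonneg (hnn u)]
    have : Real.exp (-(lam * (t - u))) ≤ 1 := Real.exp_le_one_iff.2 (by nlinarith [hu.2])
    exact mul_le_one₀ this (by linarith [hk1 u]) (by linarith [hk0 u])
  have h1 := h.jump.occupation_none_eq h.exit_pos h.rate_nn t
  simp only [h.tsum_busy] at h1
  have h2 : ∫⁻ v, (if 0 ≤ t - v then ENNReal.ofReal (1 - k (t - v)) else 0) ∂(expMeasure lam) =
      ENNReal.ofReal lam *
        ENNReal.ofReal (∫ u in 0..t, Real.exp (-(lam * (t - u))) * (1 - k u)) := by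
    -- The substitution `u = t - v` replaces the age of the current visit to `none` by the instant
    -- at which it began; survival restricts `u` to `u ≤ t` and the busy probability to `0 ≤ u`.
    rw [lintegral_expMeasure hlam
      (f := fun v => if 0 ≤ t - v then ENNReal.ofReal (1 - k (t - v)) else 0)
      (hbm.comp (measurable_id.const_sub t)),
      ← lintegral_sub_left_eq_self _ t, intervalIntegral.integral_of_le ht,
      ← integral_Icc_eq_integral_Ioc,
      ofReal_integral_eq_lintegral_ofReal hint (Eventually.of_forall hnn),
      ← lintegral_indicator measurableSet_Icc]
    congr 2
    funext u
    simp only [sub_sub_cancel, survival, indicator, mem_Icc, sub_nonneg]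
    by_cases h3 : u ≤ t <;> by_cases h4 : 0 ≤ u <;> simp [h3, h4,
      ENNReal.ofReal_mul (Real.exp_pos _).le]
  rw [h2, ← mul_assoc, ← ENNReal.ofReal_mul (div_nonneg hloss.le hlam.le),
    div_mul_cancel₀ _ hlam.ne', ← ENNReal.ofReal_mul hloss.le, survival, if_pos ht,
    ← ENNReal.ofReal_add (Real.exp_pos _).le (mul_nonneg hloss.le
      (intervalIntegral.integral_nonneg ht fun u _ => hnn u))] at h1
  rw [h1, ENNReal.toReal_ofReal]
  exact add_nonneg (Real.exp_pos _).le (mul_nonneg hloss.le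
      (intervalIntegral.integral_nonneg ht fun u _ => hnn u))

lemma tendsto_occupation (h : IsLinkChain P lam mu q p s Y H) (hlam : 0 < lam)
    (hloss : 0 < mu + lam * q * (1 - p)) :
    Tendsto (fun t => (occupation P Y H none t).toReal) atTop
      (𝓝 ((mu + lam * q * (1 - p)) / (lam + (mu + lam * q * (1 - p))))) :=
  tendsto_of_renewal hlam hloss (h.jump.measurable_occupation none).ennreal_toReal
    (fun _ => ENNReal.toReal_nonneg) (fun u =>
      ENNReal.toReal_le_of_le_ofReal zero_le_one (by simpa using h.occupation_le_one none u))
    fun _ ht => h.renewal hlam hloss ht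

lemma setIntegral_levelTimes (h : IsLinkChain P lam mu q p s Y H) (hlam : 0 < lam)
    (ha : 0 < mu + lam * q) (hqp : 0 ≤ lam * q * p) (t : ℝ≥0) (i : ℕ)
    {g : (Fin (i + 1) → ℝ) → ℝ} (hg : Continuous g) :
    ∫ ω in {ω | s t ω = some i}, g (levelTimes (fun u => s u ω) t i) ∂P =
      levelWeight lam mu q p i *
        ∫ x, (occupation P Y H none (t - ∑ j, x j)).toReal * g x ∂(iidExp (mu + lam * q) i) := by
  have hocc := h.jump.measurable_occupation none
  have hw : 0 ≤ levelWeight lam mu q p i :=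
    mul_nonneg (div_nonneg hlam.le ha.le) (pow_nonneg (div_nonneg hqp ha.le) _)
  rw [← integral_map (h.aemeasurable_levelTimes t i) hg.aestronglyMeasurable,
    h.map_levelTimes hlam ha hqp t i,
    integral_withDensity_eq_integral_toReal_smul (by fun_prop) (Eventually.of_forall fun x =>
      ENNReal.mul_lt_top ENNReal.ofReal_lt_top
        ((h.occupation_le_one none _).trans_lt ENNReal.one_lt_top)), ← integral_const_mul]
  refine integral_congr_ae (Eventually.of_forall fun x => ?_)
  simp only [ENNReal.toReal_mul, ENNReal.toReal_ofReal hw, smul_eq_mul, mul_assoc]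

/-- Level times converge in law on the event that the link is at level `i`. -/
lemma tendsto_setIntegral_levelTimes (h : IsLinkChain P lam mu q p s Y H) (hlam : 0 < lam)
    (ha : 0 < mu + lam * q) (hqp : 0 ≤ lam * q * p) (hloss : 0 < mu + lam * q * (1 - p)) (i : ℕ)
    {g : (Fin (i + 1) → ℝ) → ℝ} (hg : Continuous g) {C : ℝ}
    (hC : ∀ x, (∀ j, 0 ≤ x j) → |g x| ≤ C) :
    Tendsto (fun t : ℝ≥0 => ∫ ω in {ω | s t ω = some i}, g (levelTimes (fun u => s u ω) t i) ∂P)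
      atTop (𝓝 (levelWeight lam mu q p i *
        ((mu + lam * q * (1 - p)) / (lam + (mu + lam * q * (1 - p))) *
          ∫ x, g x ∂(iidExp (mu + lam * q) i)))) := by
  have := isProbabilityMeasure_iidExp ha i
  have hocc := h.jump.measurable_occupation none
  simp only [h.setIntegral_levelTimes hlam ha hqp _ i hg]
  refine Tendsto.const_mul _ ?_
  rw [← integral_const_mul]
  -- For fixed `x` the time `t - ∑ j, x j` tends to infinity; the bound `C` suffices since
  -- occupations are at most 1 and exponential times are nonnegative almost surely.
  refine tendsto_integral_filter_of_dominated_convergence (fun _ => C)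
    (Eventually.of_forall fun t => ?_) (Eventually.of_forall fun t => ?_)
    (integrable_const _) (Eventually.of_forall fun x => ?_)
  · have := hg.measurable
    exact Measurable.aestronglyMeasurable (by fun_prop)
  · filter_upwards [ae_iidExp_nonneg ha i] with x hx
    rw [Real.norm_eq_abs, abs_mul, abs_of_nonneg ENNReal.toReal_nonneg]
    have h1 : (occupation P Y H none (t - ∑ j, x j)).toReal ≤ 1 :=
      ENNReal.toReal_le_of_le_ofReal zero_le_one (by simpa using h.occupation_le_one none _)
    exact (mul_le_of_le_one_left (abs_nonneg _) h1).trans (hC x hx)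
  · refine Tendsto.mul_const _ ((h.tendsto_occupation hlam hloss).comp ?_)
    exact tendsto_atTop_add_const_right _ _ (NNReal.tendsto_coe_atTop.2 tendsto_id)

/-- A bound uniform in `t`, obtained by bounding the occupation of `none` by 1; it dominates the sum
over levels in the final limit. -/
lemma measureReal_level_le (h : IsLinkChain P lam mu q p s Y H) (hlam : 0 < lam)
    (ha : 0 < mu + lam * q) (hqp : 0 ≤ lam * q * p) (t : ℝ≥0) (i : ℕ) :
    P.real {ω | s t ω = some i} ≤ levelWeight lam mu q p i := by
  have := isProbabilityMeasure_iidExp ha i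
  have h1 := h.lintegral_levelTimes hlam ha hqp t i (g := 1) measurable_one
  simp only [Pi.one_apply, one_mul, setLIntegral_one] at h1
  refine ENNReal.toReal_le_of_le_ofReal
    (mul_nonneg (div_nonneg hlam.le ha.le) (pow_nonneg (div_nonneg hqp ha.le) _)) ?_
  rw [h1]
  refine mul_le_of_le_one_right' ?_
  refine (lintegral_mono fun x => h.occupation_le_one none _).trans ?_
  simp

end IsLinkChain
end Chain
-- Contribution of each level to the consumed fidelity
section Consumption

variable {Ω : Type*} [MeasurableSpace Ω] {P : Measure Ω} [IsProbabilityMeasure P]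
  {lam mu q p Γ : ℝ} {s : ℝ≥0 → Ω → Option ℕ} {Y : ℕ → Ω → Option ℕ} {H : ℕ → Ω → ℝ}
  {J : ℝ → TwoQubit → ℝ} {ρ : TwoQubit}

lemma pathFidelity_of_eq_some {f : ℝ≥0 → Option ℕ} {t : ℝ≥0} {i : ℕ} (h : f t = some i) :
    pathFidelity Γ J ρ f t = levelFidelity Γ J ρ i (levelTimes f t i) := by
  unfold pathFidelity
  rw [h]

lemma pathFidelity_of_eq_none {f : ℝ≥0 → Option ℕ} {t : ℝ≥0} (h : f t = none) :
    pathFidelity Γ J ρ f t = 0 := by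
  unfold pathFidelity
  rw [h]

lemma pathFidelity_mem_Icc (hΓ : 0 ≤ Γ) (hρ : IsState ρ)
    (hJ : ∀ F ∈ Icc (0 : ℝ) 1, J F ρ ∈ Icc (0 : ℝ) 1) (f : ℝ≥0 → Option ℕ) (t : ℝ≥0) :
    pathFidelity Γ J ρ f t ∈ Icc (0 : ℝ) 1 := by
  rcases hf : f t with _ | i
  · rw [pathFidelity_of_eq_none hf]; simp
  · rw [pathFidelity_of_eq_some hf]
    exact levelFidelity_mem_Icc hΓ hρ hJ i (levelTimes_nonneg f t i)

lemma levelFidelity_ae_eq (hΓ : 0 ≤ Γ) (hρ : IsState ρ)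
    (hJ : ∀ F ∈ Icc (0 : ℝ) 1, J F ρ ∈ Icc (0 : ℝ) 1) {a : ℝ} (ha : 0 < a) (i : ℕ) :
    levelFidelity Γ (extendJump J) ρ i =ᵐ[iidExp a i] levelFidelity Γ J ρ i := by
  filter_upwards [ae_iidExp_nonneg ha i] with x hx
  exact levelFidelity_extendJump hΓ hρ hJ i hx

lemma integrable_levelFidelity (hΓ : 0 ≤ Γ) (hρ : IsState ρ)
    (hJc : ContinuousOn (fun F => J F ρ) (Icc 0 1))
    (hJ : ∀ F ∈ Icc (0 : ℝ) 1, J F ρ ∈ Icc (0 : ℝ) 1) {a : ℝ} (ha : 0 < a) (i : ℕ) :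
    Integrable (levelFidelity Γ J ρ i) (iidExp a i) := by
  have := isProbabilityMeasure_iidExp ha i
  refine Integrable.of_bound ((continuous_levelFidelity_extendJump
    hJc i).aestronglyMeasurable.congr (levelFidelity_ae_eq hΓ hρ hJ ha i)) 1 ?_
  filter_upwards [ae_iidExp_nonneg ha i] with x hx
  have := levelFidelity_mem_Icc hΓ hρ hJ i hx
  rw [Real.norm_of_nonneg this.1]
  exact this.2

lemma integral_levelFidelity_mem_Icc (hΓ : 0 ≤ Γ) (hρ : IsState ρ)
    (hJc : ContinuousOn (fun F => J F ρ) (Icc 0 1))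
    (hJ : ∀ F ∈ Icc (0 : ℝ) 1, J F ρ ∈ Icc (0 : ℝ) 1) {a : ℝ} (ha : 0 < a) (i : ℕ) :
    ∫ x, levelFidelity Γ J ρ i x ∂(iidExp a i) ∈ Icc (0 : ℝ) 1 := by
  have := isProbabilityMeasure_iidExp ha i
  constructor
  · refine integral_nonneg_of_ae ?_
    filter_upwards [ae_iidExp_nonneg ha i] with x hx
    exact (levelFidelity_mem_Icc hΓ hρ hJ i hx).1
  · refine (integral_mono_ae (integrable_levelFidelity hΓ hρ hJc hJ ha i)
      (integrable_const (1 : ℝ)) ?_).trans (by simp)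
    filter_upwards [ae_iidExp_nonneg ha i] with x hx
    exact (levelFidelity_mem_Icc hΓ hρ hJ i hx).2

lemma integral_cond {Ω : Type*} [MeasurableSpace Ω] (P : Measure Ω) (E : Set Ω) (f : Ω → ℝ) :
    ∫ ω, f ω ∂(P[|E]) = (P.real E)⁻¹ * ∫ ω in E, f ω ∂P := by
  rw [ProbabilityTheory.cond, integral_smul_measure, ENNReal.toReal_inv, smul_eq_mul,
    measureReal_def]

namespace IsLinkChain

lemma integrable_pathFidelity (h : IsLinkChain P lam mu q p s Y H) (hΓ : 0 ≤ Γ) (hρ : IsState ρ)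
    (hJc : ContinuousOn (fun F => J F ρ) (Icc 0 1))
    (hJ : ∀ F ∈ Icc (0 : ℝ) 1, J F ρ ∈ Icc (0 : ℝ) 1) (t : ℝ≥0) :
    Integrable (fun ω => pathFidelity Γ J ρ (fun u => s u ω) t) P := by
  refine Integrable.of_bound (AEMeasurable.aestronglyMeasurable ?_) 1
    (Eventually.of_forall fun ω => ?_)
  · have hU : (⋃ x, {ω | s t ω = x}) = univ := by ext; simp
    rw [← Measure.restrict_univ (μ := P), ← hU, aemeasurable_iUnion_iff]
    rintro (_ | i)
    · refine (measurable_const (a := (0 : ℝ))).aemeasurable.congr ?_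
      filter_upwards [ae_restrict_mem (h.meas t none)] with ω hω
      exact (pathFidelity_of_eq_none hω).symm
    · refine ((continuous_levelFidelity_extendJump (Γ := Γ) hJc i).measurable.comp_aemeasurable
        (h.aemeasurable_levelTimes t i)).congr ?_
      filter_upwards [ae_restrict_mem (h.meas t (some i))] with ω hω
      rw [pathFidelity_of_eq_some (show s t ω = some i from hω)]
      exact levelFidelity_extendJump hΓ hρ hJ i (levelTimes_nonneg _ t i)
  · have := pathFidelity_mem_Icc hΓ hρ hJ (fun u => s u ω) t
    rw [Real.norm_of_nonneg this.1]
    exact this.2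

lemma setIntegral_pathFidelity_eq_tsum (h : IsLinkChain P lam mu q p s Y H) (hΓ : 0 ≤ Γ)
    (hρ : IsState ρ) (hJc : ContinuousOn (fun F => J F ρ) (Icc 0 1))
    (hJ : ∀ F ∈ Icc (0 : ℝ) 1, J F ρ ∈ Icc (0 : ℝ) 1) (t : ℝ≥0) :
    ∫ ω in {ω | s t ω ≠ none}, pathFidelity Γ J ρ (fun u => s u ω) t ∂P =
      ∑' i, ∫ ω in {ω | s t ω = some i}, pathFidelity Γ J ρ (fun u => s u ω) t ∂P := by
  have hU : {ω | s t ω ≠ none} = ⋃ i, {ω | s t ω = some i} := by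
    ext ω
    simp [Option.ne_none_iff_exists']
  rw [hU]
  refine integral_iUnion (fun i => h.meas t _) (fun i j hij => ?_)
    (h.integrable_pathFidelity hΓ hρ hJc hJ t).integrableOn
  refine Set.disjoint_left.2 fun ω h1 h2 => hij ?_
  exact Option.some.inj ((show s t ω = some i from h1).symm.trans h2)

/-- Contribution of level `i` to the consumed fidelity. -/
lemma tendsto_setIntegral_pathFidelity (h : IsLinkChain P lam mu q p s Y H) (hlam : 0 < lam)
    (ha : 0 < mu + lam * q) (hqp : 0 ≤ lam * q * p) (hloss : 0 < mu + lam * q * (1 - p))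
    (hΓ : 0 ≤ Γ) (hρ : IsState ρ) (hJc : ContinuousOn (fun F => J F ρ) (Icc 0 1))
    (hJ : ∀ F ∈ Icc (0 : ℝ) 1, J F ρ ∈ Icc (0 : ℝ) 1) (i : ℕ) :
    Tendsto (fun t : ℝ≥0 =>
        ∫ ω in {ω | s t ω = some i}, pathFidelity Γ J ρ (fun u => s u ω) t ∂P)
      atTop (𝓝 (levelWeight lam mu q p i *
        ((mu + lam * q * (1 - p)) / (lam + (mu + lam * q * (1 - p))) *
          ∫ x, levelFidelity Γ J ρ i x ∂(iidExp (mu + lam * q) i)))) := by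
  rw [← integral_congr_ae (levelFidelity_ae_eq hΓ hρ hJ ha i)]
  have h1 := h.tendsto_setIntegral_levelTimes hlam ha hqp hloss i
    (continuous_levelFidelity_extendJump (Γ := Γ) hJc i) (C := 1) fun x hx => by
      have := levelFidelity_mem_Icc hΓ hρ hJ i hx
      rw [levelFidelity_extendJump hΓ hρ hJ i hx, abs_of_nonneg this.1]
      exact this.2
  refine h1.congr fun t => setIntegral_congr_fun (h.meas t _) fun ω hω => ?_
  rw [pathFidelity_of_eq_some (show s t ω = some i from hω)]
  exact levelFidelity_extendJump hΓ hρ hJ i (levelTimes_nonneg _ t i)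

lemma tendsto_measureReal_level (h : IsLinkChain P lam mu q p s Y H) (hlam : 0 < lam)
    (ha : 0 < mu + lam * q) (hqp : 0 ≤ lam * q * p) (hloss : 0 < mu + lam * q * (1 - p)) (i : ℕ) :
    Tendsto (fun t => P.real {ω | s t ω = some i}) atTop (𝓝 (levelWeight lam mu q p i *
        ((mu + lam * q * (1 - p)) / (lam + (mu + lam * q * (1 - p)))))) := by
  have := isProbabilityMeasure_iidExp ha i
  have h1 := h.tendsto_setIntegral_levelTimes hlam ha hqp hloss i (g := fun _ => (1 : ℝ))
    continuous_const (C := 1) (by simp)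
  simpa using h1

lemma tendsto_measureReal_none (h : IsLinkChain P lam mu q p s Y H) (hlam : 0 < lam)
    (hloss : 0 < mu + lam * q * (1 - p)) :
    Tendsto (fun t => P.real {ω | s t ω = none}) atTop
      (𝓝 ((mu + lam * q * (1 - p)) / (lam + (mu + lam * q * (1 - p))))) := by
  simp only [h.measureReal_none]
  exact (h.tendsto_occupation hlam hloss).comp (NNReal.tendsto_coe_atTop.2 tendsto_id)

end IsLinkChain

end Consumption

/-! ### Steady state and proof of the theorem -/

/-- Steady-state distribution of the 1G1B system. -/
noncomputable def steadyState (lam mu q p : ℝ) : Option ℕ → ℝ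
  | none => (mu + lam * q * (1 - p)) / (lam + (mu + lam * q * (1 - p)))
  | some i => levelWeight lam mu q p i *
      ((mu + lam * q * (1 - p)) / (lam + (mu + lam * q * (1 - p))))

end Buffer

theorem theorem1 {Ω : Type*} [MeasurableSpace Ω] (P : Measure Ω) [IsProbabilityMeasure P]
    (lam mu q p Γ : ℝ) (hlam : 0 < lam) (hmu : 0 ≤ mu)
    (hq : q ∈ Set.Icc (0 : ℝ) 1) (hp : p ∈ Set.Icc (0 : ℝ) 1)
    (hloss : 0 < mu + lam * q * (1 - p)) (hΓ : 0 ≤ Γ)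
    (ρnew : Buffer.TwoQubit) (hρ : Buffer.IsState ρnew)
    (J : ℝ → Buffer.TwoQubit → ℝ)
    (hJcont : ContinuousOn (fun F => J F ρnew) (Set.Icc 0 1))
    (hJmaps : ∀ F ∈ Set.Icc (0 : ℝ) 1, J F ρnew ∈ Set.Icc (0 : ℝ) 1)
    (s : ℝ≥0 → Ω → Option ℕ) (hs : Buffer.Is1G1B P lam mu q p s) :
    ∃ π : Option ℕ → ℝ,
      -- `π` is the steady-state distribution, and the availability `1 - π none` is positive
      (∀ x, Tendsto (fun t => P.real {ω | s t ω = x}) atTop (𝓝 (π x))) ∧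
      0 < 1 - π none ∧
      (∀ t, Integrable (fun ω => Buffer.pathFidelity Γ J ρnew (fun u => s u ω) t) P) ∧
      -- given level `i`, the level times converge in distribution to i.i.d. exponentials
      (∀ i : ℕ, 0 < π (some i) → ∀ g : BoundedContinuousFunction (Fin (i + 1) → ℝ) ℝ,
        Tendsto (fun t => ∫ ω, g (Buffer.levelTimes (fun u => s u ω) t i)
            ∂(P[|{ω | s t ω = some i}]))
          atTop (𝓝 (∫ x, g x ∂(Buffer.iidExp (mu + lam * q) i)))) ∧
      -- the average consumed fidelity
      (∀ i : ℕ, Integrable (Buffer.levelFidelity Γ J ρnew i) (Buffer.iidExp (mu + lam * q) i)) ∧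
      Summable (fun i : ℕ =>
        (∫ x, Buffer.levelFidelity Γ J ρnew i x ∂(Buffer.iidExp (mu + lam * q) i)) *
          π (some i)) ∧
      Tendsto (fun t => ∫ ω, Buffer.pathFidelity Γ J ρnew (fun u => s u ω) t
          ∂(P[|{ω | s t ω ≠ none}]))
        atTop
        (𝓝 (1 / (1 - π none) * ∑' i : ℕ,
          (∫ x, Buffer.levelFidelity Γ J ρnew i x ∂(Buffer.iidExp (mu + lam * q) i)) *
            π (some i))) := by
  open Buffer in
  have hqp : 0 ≤ lam * q * p := mul_nonneg (mul_nonneg hlam.le hq.1) hp.1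
  have ha : 0 < mu + lam * q := by linarith
  obtain ⟨Y, H, h⟩ := hs.exists_isLinkChain hlam hmu hq hp ha
  have hA : 0 < 1 - steadyState lam mu q p none := by
    rw [steadyState, sub_pos, div_lt_one (by linarith)]
    linarith
  have hw0 := levelWeight_nonneg hlam hq hp ha
  have hws := summable_levelWeight hlam hq hp ha hloss
  have hnone : Tendsto (fun t => P.real {ω | s t ω = none}) atTop
      (𝓝 (steadyState lam mu q p none)) := h.tendsto_measureReal_none hlam hloss
  have hsome : ∀ i, Tendsto (fun t => P.real {ω | s t ω = some i}) atTop
      (𝓝 (steadyState lam mu q p (some i))) :=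
    h.tendsto_measureReal_level hlam ha hqp hloss
  have hc0 : 0 ≤ steadyState lam mu q p none := ge_of_tendsto' hnone fun t => measureReal_nonneg
  refine ⟨steadyState lam mu q p, ?_, hA, h.integrable_pathFidelity hΓ hρ hJcont hJmaps,
    fun i hi g => ?_, integrable_levelFidelity hΓ hρ hJcont hJmaps ha, ?_, ?_⟩
  · rintro (_ | i)
    exacts [hnone, hsome i]
  · simp only [integral_cond]
    have h1 := (hsome i).inv₀ hi.ne'
    have h2 := h.tendsto_setIntegral_levelTimes hlam ha hqp hloss i g.continuous (C := ‖g‖)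
      fun x _ => g.norm_coe_le_norm x
    have h3 := h1.mul h2
    -- The limiting mass of level `i` factors out of the restricted integral and cancels against the
    -- normalisation of the conditional law.
    rwa [← mul_assoc (levelWeight lam mu q p i), show levelWeight lam mu q p i *
      ((mu + lam * q * (1 - p)) / (lam + (mu + lam * q * (1 - p)))) =
      steadyState lam mu q p (some i) from rfl, inv_mul_cancel_left₀ hi.ne'] at h3
  · refine Summable.of_nonneg_of_le (fun i => mul_nonneg
      (integral_levelFidelity_mem_Icc hΓ hρ hJcont hJmaps ha i).1 (mul_nonneg (hw0 i) hc0))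
      (fun i => ?_) (hws.mul_right (steadyState lam mu q p none))
    exact mul_le_of_le_one_left (mul_nonneg (hw0 i) hc0)
      (integral_levelFidelity_mem_Icc hΓ hρ hJcont hJmaps ha i).2
  · simp only [integral_cond, h.setIntegral_pathFidelity_eq_tsum hΓ hρ hJcont hJmaps, one_div]
    refine Tendsto.mul (Tendsto.inv₀ ?_ hA.ne') ?_
    · have hc : ∀ t, P.real {ω | s t ω ≠ none} = 1 - P.real {ω | s t ω = none} := fun t =>
        probReal_compl_eq_one_sub (h.meas t none)
      simp only [hc]
      exact hnone.const_sub 1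
    -- Fidelities are at most 1, so the term of level `i` is bounded by the probability of that
    -- level, hence by its weight, for every `t`.
    · refine tendsto_tsum_of_dominated_convergence hws (fun i => ?_)
        (Eventually.of_forall fun t i => ?_)
      · have h1 := h.tendsto_setIntegral_pathFidelity hlam ha hqp hloss hΓ hρ hJcont hJmaps i
        rwa [← mul_assoc, mul_comm] at h1
      · refine (norm_setIntegral_le_of_norm_le_const (C := 1) (measure_lt_top _ _)
          fun ω _ => ?_).trans ?_
        · have := pathFidelity_mem_Icc hΓ hρ hJmaps (fun u => s u ω) t
          rw [Real.norm_of_nonneg this.1]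
          exact this.2
        · rw [one_mul]
          exact h.measureReal_level_le hlam ha hqp t i
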